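/- Let $G$ be a finite $2$-group, and let $A$ be a finite $2$-group acting on $G$ by automorphisms. Write $G^4=\langle x^4 \mid x\in G\rangle$ for the subgroup generated by the fourth powers of the elements of $G$; it is normal and $A$-invariant, so $A$ acts on $G/G^4$. For a finite group $X$, let $d(X)$ denote the minimal number of generators of $X$. If $A$ acts on $X$, then $X$ is called $d$-maximal for $A$-subgroups if $d(H)<d(X)$ for every proper $A$-invariant subgroup $H$ of $X$. A group $X$ is called metacyclic if it has a cyclic normal subgroup $N$ such that $X/N$ is cyclic, and minimal non-metacyclic if it is not metacyclic but all its proper subgroups are. (i) If $G/G^4$ is $d$-maximal for $A$-subgroups, then so is $G$. (ii) If $G/G^4$ is minimal non-metacyclic, then so is $G$. -/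

import Mathlib

/-- `G^n`: the subgroup generated by the `n`-th powers of the elements of `G`. -/
def powSubgroup (G : Type*) [Group G] (n : ℕ) : Subgroup G :=
  Subgroup.closure (Set.range fun x : G => x ^ n)

/-- `G^n` is fully invariant: every endomorphism of `G` maps it into itself. -/
theorem map_mem_powSubgroup {G : Type*} [Group G] (n : ℕ) (f : G →* G) {x : G}
    (hx : x ∈ powSubgroup G n) : f x ∈ powSubgroup G n := by
  have h : powSubgroup G n ≤ (powSubgroup G n).comap f := by
    unfold powSubgroup
    rw [Subgroup.closure_le]
    rintro _ ⟨y, rfl⟩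
    exact Subgroup.subset_closure ⟨f y, (map_pow f y n).symm⟩
  exact h hx

instance powSubgroup_normal (G : Type*) [Group G] (n : ℕ) : (powSubgroup G n).Normal where
  conj_mem := fun x hx g => by
    simpa using map_mem_powSubgroup n (MulAut.conj g).toMonoidHom hx

/-- An action of `A` on `G` by automorphisms descends to the set of cosets of `G^n`, by
`a • (g G^n) = (a • g) G^n`. -/
instance powSubgroup_quotientAction (A G : Type*) [Group A] [Group G] [MulDistribMulAction A G]
    (n : ℕ) : MulAction.QuotientAction A (powSubgroup G n) where
  inv_mul_mem := fun a x y h => by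
    simpa using map_mem_powSubgroup n (MulDistribMulAction.toMonoidHom G a) h

/-- The induced action of `A` on the group `G ⧸ G^n` is an action by automorphisms. -/
instance powSubgroup_mulDistribMulAction (A G : Type*) [Group A] [Group G]
    [MulDistribMulAction A G] (n : ℕ) : MulDistribMulAction A (G ⧸ powSubgroup G n) where
  smul_mul := by
    rintro a ⟨x⟩ ⟨y⟩
    exact congrArg (QuotientGroup.mk (s := powSubgroup G n)) (smul_mul' a x y)
  smul_one := fun a => congrArg (QuotientGroup.mk (s := powSubgroup G n)) (smul_one a)

/-- A finite group `G` acted on by `A` is `d`-maximal for `A`-subgroups if `d(H) < d(G)` for every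
proper `A`-invariant subgroup `H` of `G`, where `d` (`Group.rank`) denotes the minimal number of
generators. -/
def IsDMaximalFor (A G : Type*) [Group A] [Group G] [Finite G] [MulDistribMulAction A G] : Prop :=
  ∀ H : Subgroup G, (∀ a : A, ∀ h ∈ H, a • h ∈ H) → H ≠ ⊤ → Group.rank H < Group.rank G

/-- A group is metacyclic if it has a cyclic normal subgroup with cyclic quotient. -/
def IsMetacyclic (X : Type*) [Group X] : Prop :=
  ∃ (N : Subgroup X) (_ : N.Normal), IsCyclic N ∧ IsCyclic (X ⧸ N)

/-- A group is minimal non-metacyclic if it is not metacyclic but all its proper subgroups are. -/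
def IsMinimalNonMetacyclic (X : Type*) [Group X] : Prop :=
  ¬ IsMetacyclic X ∧ ∀ H : Subgroup X, H ≠ ⊤ → IsMetacyclic H

/-! Write `P` for the subgroup generated by the squares of `G`. In a finite 2-group `H` the subgroup
`H.squares` is the Frattini subgroup, and |H : H.squares| = 2^d(H) (`relIndex_squares`), so every
comparison of generator numbers is a comparison of indices.

(i) A d-maximal group X satisfies [Φ(X), X] ≤ Φ(Φ(X)) (`IsDMaximalFor.commutator_squares_le`):
otherwise the centralizer C of Φ(X), modulo a suitable T, is a proper invariant subgroup with d(C) ≥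
d(X). Since G^4 ≤ `P.squares`, this property of G/G^4 lifts to [P, G] ≤ `P.squares`. It forces P to
be powerful (`commutator_squares_top_le`), so a subgroup of P needs no more generators than P. Hence
d(H) ≤ d(HP) for every H ≤ G (`relIndex_squares_le_sup`). If H is proper, so is HP; as G^4 lies in
the squares of HP, d(HP) can be computed in G/G^4, where it is less than d(G/G^4) ≤ d(G).

(ii) A 2-group all of whose subgroups are two-generated is metacyclic
(`isMetacyclic_of_forall_rank_le`). So if G/G^4 is minimal non-metacyclic, it needs at least three
generators while its proper subgroups need at most two: it is d-maximal for the trivial action. The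
comparison in (i) then shows that all proper subgroups of G are two-generated, and the criterion
applies to each of them.

The criterion is proved by induction on |G|. A central involution z in R = [G', G](G')^2 can be
factored out (`isMetacyclic_of_quotient_zpowers`). If R = 1, then G' is generated by one central
element c with c^2 = 1. If such a G were not metacyclic, c ≠ 1 would be a 2^k-th power for every k,
which is absurd. -/

open scoped commutatorElement

/-! ### Subgroups generated by squares, and the Frattini subgroup. -/

namespace Subgroup

variable {G G' : Type*} [Group G] [Group G']

/-- The subgroup generated by the squares of the elements of `H`. -/
def squares (H : Subgroup G) : Subgroup G :=
  closure {x | ∃ h ∈ H, h ^ 2 = x}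

theorem sq_mem_squares {H : Subgroup G} {h : G} (hh : h ∈ H) : h ^ 2 ∈ H.squares :=
  subset_closure ⟨h, hh, rfl⟩

theorem squares_le_iff {H K : Subgroup G} : H.squares ≤ K ↔ ∀ h ∈ H, h ^ 2 ∈ K := by
  unfold squares
  rw [closure_le]
  exact ⟨fun h x hx => h ⟨x, hx, rfl⟩, fun h _ ⟨x, hx, e⟩ => e ▸ h x hx⟩

theorem squares_mono {H K : Subgroup G} (h : H ≤ K) : H.squares ≤ K.squares :=
  squares_le_iff.2 fun _ hx => sq_mem_squares (h hx)

theorem squares_le_self (H : Subgroup G) : H.squares ≤ H :=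
  squares_le_iff.2 fun _ hx => pow_mem hx 2

theorem map_squares (f : G →* G') (H : Subgroup G) : H.squares.map f = (H.map f).squares := by
  apply le_antisymm
  · rw [map_le_iff_le_comap, squares_le_iff]
    intro h hh
    rw [mem_comap, map_pow]
    exact sq_mem_squares (mem_map_of_mem f hh)
  · rw [squares_le_iff]
    rintro _ ⟨h, hh, rfl⟩
    rw [← map_pow]
    exact mem_map_of_mem f (sq_mem_squares hh)

instance squares_normal (H : Subgroup G) [hH : H.Normal] : H.squares.Normal where
  conj_mem x hx g := by
    have : H.squares.map (MulAut.conj g).toMonoidHom ≤ H.squares := by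
      rw [map_squares]
      apply squares_mono
      rintro _ ⟨y, hy, rfl⟩
      exact hH.conj_mem y hy g
    exact this ⟨x, hx, rfl⟩

theorem smul_mem_squares {A : Type*} [Group A] [MulDistribMulAction A G] {H : Subgroup G}
    (hH : ∀ a : A, ∀ h ∈ H, a • h ∈ H) (a : A) : ∀ h ∈ H.squares, a • h ∈ H.squares := by
  intro x hx
  have : H.squares.map (MulDistribMulAction.toMonoidHom G a) ≤ H.squares := by
    rw [map_squares]
    apply squares_mono
    rintro _ ⟨y, hy, rfl⟩
    exact hH a y hy
  exact this ⟨x, hx, rfl⟩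

theorem commutator_le_squares (H : Subgroup G) : ⁅H, H⁆ ≤ H.squares := by
  rw [commutator_le]
  intro x hx y hy
  have : ⁅x, y⁆ = x ^ 2 * (x⁻¹ * y) ^ 2 * (y⁻¹) ^ 2 := by
    simp [commutatorElement_def, sq, mul_assoc]
  rw [this]
  exact mul_mem (mul_mem (sq_mem_squares hx) (sq_mem_squares (mul_mem (inv_mem hx) hy)))
    (sq_mem_squares (inv_mem hy))

/-- A maximal subgroup M is normal. If x^2 ∉ M, then G = ⟨x^2⟩M, which puts an odd power of x in M;
as x has 2-power order, x itself lies in M. -/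
theorem squares_top_le_frattini [Finite G] (hG : IsPGroup 2 G) :
    (⊤ : Subgroup G).squares ≤ frattini G := by
  have : Fact (Nat.Prime 2) := ⟨Nat.prime_two⟩
  have := hG.isNilpotent
  rw [squares_le_iff]
  intro x _
  rw [frattini, Order.radical]
  simp only [mem_iInf]
  intro M hM
  by_contra hx
  have : M.Normal := NormalizerCondition.normal_of_coatom M
    Group.normalizerCondition_of_isNilpotent hM
  have htop : zpowers (x ^ 2) ⊔ M = ⊤ :=
    hM.2 _ (lt_of_le_of_ne le_sup_right fun h => hx (h ▸ (le_sup_left : zpowers (x ^ 2) ≤ _)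
      (mem_zpowers _)))
  have hxm : x ∈ zpowers (x ^ 2) ⊔ M := htop ▸ mem_top x
  obtain ⟨_, ⟨k, rfl⟩, m, hm, e⟩ := mem_sup_of_normal_right.1 hxm
  obtain ⟨n, hn⟩ := hG x
  have h1 : x ^ (1 - 2 * k) ∈ M := by
    have : x ^ (1 - 2 * k) = m := by
      have e' : (x ^ 2) ^ k * m = x := e
      calc x ^ (1 - 2 * k) = ((x ^ 2) ^ k)⁻¹ * x := by
            rw [← zpow_natCast, ← zpow_mul, ← zpow_neg, ← zpow_add_one]
            congr 1; push_cast; ring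
        _ = m := by rw [inv_mul_eq_iff_eq_mul, e']
    rwa [this]
  have hcop : IsCoprime (1 - 2 * k) ((2 : ℤ) ^ n) :=
    IsCoprime.pow_right ⟨1, k, by ring⟩
  obtain ⟨u, v, huv⟩ := hcop
  apply hx
  have : x = (x ^ (1 - 2 * k)) ^ u * (x ^ (2 ^ n)) ^ v := by
    rw [← zpow_natCast x, ← zpow_mul, ← zpow_mul, ← zpow_add]
    push_cast
    rw [mul_comm _ u, mul_comm _ v, huv, zpow_one]
  rw [this, hn, one_zpow, mul_one]
  exact pow_mem (zpow_mem h1 u) 2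

theorem eq_top_of_sup_squares_top [Finite G] (hG : IsPGroup 2 G) {H : Subgroup G}
    (h : H ⊔ (⊤ : Subgroup G).squares = ⊤) : H = ⊤ :=
  frattini_nongenerating (top_unique (h ▸ sup_le_sup_left (squares_top_le_frattini hG) H))

end Subgroup

/-! ### The number of generators as an index. -/

open Subgroup in
theorem two_pow_rank_le_card (G : Type*) [Group G] [Finite G] :
    2 ^ Group.rank G ≤ Nat.card G := by
  classical
  obtain ⟨S, hS, hSt⟩ := Group.rank_spec G
  have key : ∀ T : Finset G, T ⊆ S → 2 ^ T.card ≤ Nat.card (closure (T : Set G)) := by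
    intro T
    induction T using Finset.induction_on with
    | empty => intro _; simp
    | insert a T ha ih =>
      intro hTS
      rw [Finset.insert_subset_iff] at hTS
      have hle : closure (T : Set G) ≤ closure ((insert a T : Finset G) : Set G) :=
        closure_mono (by simp)
      -- No element of a generating set of least size is redundant, so each insertion at least
      -- doubles the subgroup.
      have hna : a ∉ closure (T : Set G) := by
        intro hmem
        have hsub : closure (T : Set G) ≤ closure ((S.erase a : Finset G) : Set G) :=
          closure_mono fun t ht => by
            rw [Finset.mem_coe] at ht ⊢
            exact Finset.mem_erase.2 ⟨fun h => ha (h ▸ ht), hTS.2 ht⟩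
        have : closure ((S.erase a : Finset G) : Set G) = ⊤ := by
          rw [eq_top_iff, ← hSt, closure_le]
          intro s hs
          by_cases hsa : s = a
          · subst hsa; exact hsub hmem
          · exact subset_closure (Finset.mem_coe.2 (Finset.mem_erase.2 ⟨hsa, hs⟩))
        have h1 := Group.rank_le this
        have h2 := Finset.card_erase_lt_of_mem hTS.1
        omega
      have hlt : closure (T : Set G) < closure ((insert a T : Finset G) : Set G) :=
        lt_of_le_of_ne hle fun h => hna (h ▸ subset_closure (by simp))
      have h1 := ih hTS.2
      have h3 := relIndex_mul_relIndex ⊥ _ _ bot_le hle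
      rw [relIndex_bot_left, relIndex_bot_left] at h3
      have h4 : (closure (T : Set G)).relIndex (closure ((insert a T : Finset G) : Set G)) ≠ 1 :=
        fun h => hlt.not_ge (relIndex_eq_one.1 h)
      have h5 : (closure (T : Set G)).relIndex (closure ((insert a T : Finset G) : Set G)) ≠ 0 :=
        index_ne_zero_of_finite
      rw [Finset.card_insert_of_notMem ha, pow_succ, ← h3]
      exact Nat.mul_le_mul h1 (by omega)
  have := key S subset_rfl
  rw [hSt, hS] at this
  simpa using this

namespace Subgroup

/-- Burnside's basis theorem: the quotient is elementary abelian, and generators of it lift to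
generators of G because squares lie in the Frattini subgroup. -/
theorem index_squares_top {G : Type*} [Group G] [Finite G] (hG : IsPGroup 2 G) :
    (⊤ : Subgroup G).squares.index = 2 ^ Group.rank G := by
  classical
  set Q := G ⧸ (⊤ : Subgroup G).squares with hQ
  have hsq : ∀ q : Q, q ^ 2 = 1 := by
    rintro ⟨x⟩
    exact (QuotientGroup.eq_one_iff _).2 (sq_mem_squares (mem_top x))
  have hcard : Nat.card Q ≤ 2 ^ Group.rank Q := by
    let _ : CommGroup Q := { (inferInstance : Group Q) with
      mul_comm := fun a b => by
        have h : ∀ q : Q, q * q = 1 := fun q => by rw [← sq, hsq]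
        have hi : ∀ q : Q, q⁻¹ = q := fun q => inv_eq_of_mul_eq_one_left (h q)
        calc a * b = (a * b)⁻¹ := (hi _).symm
          _ = b * a := by rw [mul_inv_rev, hi, hi] }
    exact Nat.le_of_dvd (by positivity) (card_dvd_exponent_pow_rank' Q hsq)
  have hle : Group.rank Q ≤ Group.rank G :=
    Group.rank_le_of_surjective (QuotientGroup.mk' _) (QuotientGroup.mk'_surjective _)
  have hge : Group.rank G ≤ Group.rank Q := by
    obtain ⟨S, hS, hSt⟩ := Group.rank_spec Q
    let s : Q → G := Quotient.out
    have hs : ∀ q : Q, (QuotientGroup.mk' (⊤ : Subgroup G).squares) (s q) = q := fun q =>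
      Quotient.out_eq q
    have : closure ((S.image s : Finset G) : Set G) = ⊤ := by
      apply eq_top_of_sup_squares_top hG
      have h1 : (closure ((S.image s : Finset G) : Set G)).map
          (QuotientGroup.mk' (⊤ : Subgroup G).squares) = ⊤ := by
        rw [eq_top_iff, ← hSt, closure_le]
        intro q hq
        exact ⟨s q, subset_closure (by simpa using ⟨q, hq, rfl⟩), hs q⟩
      have h2 := congrArg (comap (QuotientGroup.mk' (⊤ : Subgroup G).squares)) h1
      rwa [comap_map_eq, QuotientGroup.ker_mk', comap_top] at h2
    exact (Group.rank_le this).trans (hS ▸ Finset.card_image_le)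
  rw [le_antisymm hge hle, index_eq_card]
  exact le_antisymm hcard (two_pow_rank_le_card Q)

theorem relIndex_squares {G : Type*} [Group G] [Finite G] (hG : IsPGroup 2 G) (H : Subgroup G) :
    H.squares.relIndex H = 2 ^ Group.rank H := by
  rw [← index_squares_top (hG.to_subgroup H), relIndex]
  congr 1
  apply map_injective H.subtype_injective
  rw [map_squares, ← MonoidHom.range_eq_map, range_subtype, subgroupOf_map_subtype]
  exact inf_of_le_left H.squares_le_self

end Subgroup

/-! ### Commutators with squares, and powerful 2-groups. -/

theorem commutatorElement_sq_left {G : Type*} [Group G] (g x : G) :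
    ⁅g ^ 2, x⁆ = ⁅g, ⁅g, x⁆⁆ * ⁅g, x⁆ ^ 2 := by
  simp [commutatorElement_def, sq, mul_assoc]

namespace Subgroup

variable {G : Type*} [Group G]

/-- Modulo N the centralizer of x is a subgroup, so it suffices to test the generating squares. -/
theorem commutator_squares_le {H L N : Subgroup G} [hN : N.Normal]
    (h : ∀ g ∈ H, ∀ x ∈ L, ⁅g ^ 2, x⁆ ∈ N) : ⁅H.squares, L⁆ ≤ N := by
  rw [commutator_le]
  intro y hy x hx
  have : H.squares ≤ (centralizer {QuotientGroup.mk' N x}).comap (QuotientGroup.mk' N) := by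
    rw [squares_le_iff]
    intro g hg
    rw [mem_comap, mem_centralizer_singleton_iff, ← commutatorElement_eq_one_iff_mul_comm,
      ← map_commutatorElement]
    exact (QuotientGroup.eq_one_iff _).2 (h g hg x hx)
  have h2 := this hy
  rw [mem_comap, mem_centralizer_singleton_iff, ← commutatorElement_eq_one_iff_mul_comm,
    ← map_commutatorElement] at h2
  exact (QuotientGroup.eq_one_iff _).1 h2

theorem eq_bot_of_le_commutator_top [Group.IsNilpotent G] {N : Subgroup G} (h : N ≤ ⁅N, ⊤⁆) :
    N = ⊥ := by
  obtain ⟨n, hn⟩ := nilpotent_iff_lowerCentralSeries.1 ‹Group.IsNilpotent G›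
  have key : ∀ k, N ≤ (⊤ : Subgroup G).lowerCentralSeries k := by
    intro k
    induction k with
    | zero => simp
    | succ k ih =>
      rw [lowerCentralSeries_succ]
      exact h.trans (commutator_mono ih le_rfl)
  exact le_bot_iff.1 (hn ▸ key n)

theorem le_of_le_commutator_top_sup [Group.IsNilpotent G] {R T : Subgroup G} [T.Normal]
    (h : R ≤ ⁅R, ⊤⁆ ⊔ T) : R ≤ T := by
  have h1 : R.map (QuotientGroup.mk' T) ≤ ⁅R.map (QuotientGroup.mk' T), ⊤⁆ := by
    have := map_mono (f := QuotientGroup.mk' T) h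
    rwa [map_sup, map_commutator, QuotientGroup.map_mk'_self, sup_bot_eq,
      map_top_of_surjective _ (QuotientGroup.mk'_surjective T)] at this
  have h2 := eq_bot_of_le_commutator_top h1
  rwa [map_eq_bot_iff, QuotientGroup.ker_mk'] at h2

/-- Here K = Φ(P) has exponent 2, so the expansion of [g^2, x] loses its square term whenever [g, x]
∈ K. Used twice, this gives [K, G] ≤ [P, K] ≤ [[K, G], G], so K is central by nilpotency; a third
use gives [P, P] = 1. -/
theorem commutator_squares_eq_bot [Group.IsNilpotent G]
    (h : ⁅(⊤ : Subgroup G).squares, ⊤⁆ ≤ (⊤ : Subgroup G).squares.squares)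
    (hK : (⊤ : Subgroup G).squares.squares.squares = ⊥) :
    ⁅(⊤ : Subgroup G).squares, (⊤ : Subgroup G).squares⁆ = ⊥ := by
  set P := (⊤ : Subgroup G).squares with hP
  set K := P.squares with hKd
  have hsq : ∀ w ∈ K, w ^ 2 = 1 := fun w hw => by
    rw [← mem_bot, ← hK]; exact sq_mem_squares hw
  have h1 : ⁅K, ⊤⁆ ≤ ⁅P, K⁆ := by
    apply commutator_squares_le
    intro u hu x _
    have hw : ⁅u, x⁆ ∈ K := h (commutator_mem_commutator hu (mem_top x))
    rw [commutatorElement_sq_left, hsq _ hw, mul_one]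
    exact commutator_mem_commutator hu hw
  have h2 : ⁅P, K⁆ ≤ ⁅(⊤ : Subgroup G), ⁅K, ⊤⁆⁆ := by
    apply commutator_squares_le
    intro g _ k hk
    have hw : ⁅g, k⁆ ∈ ⁅K, (⊤ : Subgroup G)⁆ := by
      rw [commutator_comm]; exact commutator_mem_commutator (mem_top g) hk
    rw [commutatorElement_sq_left, hsq _ (commutator_le_left K ⊤ hw), mul_one]
    exact commutator_mem_commutator (mem_top g) hw
  have h3 : ⁅K, (⊤ : Subgroup G)⁆ = ⊥ := by
    apply eq_bot_of_le_commutator_top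
    exact (h1.trans h2).trans_eq (commutator_comm _ _)
  rw [eq_bot_iff]
  apply commutator_squares_le
  intro g _ u hu
  have hw : ⁅g, u⁆ ∈ K := h (by
    rw [commutator_comm]; exact commutator_mem_commutator (mem_top g) hu)
  rw [commutatorElement_sq_left, hsq _ hw, mul_one, ← h3, commutator_comm]
  exact commutator_mem_commutator (mem_top g) hw

theorem commutator_squares_top_le [Group.IsNilpotent G]
    (h : ⁅(⊤ : Subgroup G).squares, ⊤⁆ ≤ (⊤ : Subgroup G).squares.squares) :
    ⁅(⊤ : Subgroup G).squares, (⊤ : Subgroup G).squares⁆ ≤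
      (⊤ : Subgroup G).squares.squares.squares := by
  set N := (⊤ : Subgroup G).squares.squares.squares with hN
  have hs : (⊤ : Subgroup G).map (QuotientGroup.mk' N) = ⊤ :=
    map_top_of_surjective _ (QuotientGroup.mk'_surjective N)
  have h1 := commutator_squares_eq_bot (G := G ⧸ N)
    (by have := map_mono (f := QuotientGroup.mk' N) h
        simpa only [map_commutator, map_squares, hs] using this)
    (by rw [← hs, ← map_squares, ← map_squares, ← map_squares, ← hN, QuotientGroup.map_mk'_self])
  rwa [← hs, ← map_squares, ← map_commutator, map_eq_bot_iff, QuotientGroup.ker_mk'] at h1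

/-- If `P` is powerful then so is the subgroup generated by its squares. -/
theorem commutator_squares_le_of_commutator_le [Finite G] (hG : IsPGroup 2 G) {P : Subgroup G}
    (h : ⁅P, P⁆ ≤ P.squares.squares) :
    ⁅P.squares, P.squares⁆ ≤ P.squares.squares.squares := by
  have : Fact (Nat.Prime 2) := ⟨Nat.prime_two⟩
  have := (hG.to_subgroup P).isNilpotent
  have hP : (⊤ : Subgroup P).map P.subtype = P := by
    rw [← MonoidHom.range_eq_map, range_subtype]
  have h1 : ⁅(⊤ : Subgroup P).squares, ⊤⁆ ≤ (⊤ : Subgroup P).squares.squares := by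
    rw [← map_le_map_iff_of_injective P.subtype_injective]
    simp only [map_commutator, map_squares, hP]
    exact (commutator_mono P.squares_le_self le_rfl).trans h
  have h2 := map_mono (f := P.subtype) (commutator_squares_top_le h1)
  simpa only [map_commutator, map_squares, hP] using h2

/-! ### Comparing generator numbers of subgroups. -/

theorem relIndex_mul_card {H K : Subgroup G} (h : K ≤ H) :
    K.relIndex H * Nat.card K = Nat.card H := by
  have := relIndex_mul_relIndex ⊥ K H bot_le h
  rwa [relIndex_bot_left, relIndex_bot_left, mul_comm] at this

theorem card_sup_mul_card_inf (H N : Subgroup G) [N.Normal] :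
    Nat.card (H ⊔ N : Subgroup G) * Nat.card (H ⊓ N : Subgroup G) = Nat.card H * Nat.card N := by
  rw [← relIndex_mul_card (le_sup_right : N ≤ H ⊔ N), ← relIndex_mul_card (inf_le_left : H ⊓ N ≤ H),
    relIndex_sup_right, inf_relIndex_left]
  ring

/-- The commutator hypothesis gives (HN)^2 = H^2 N^2. The product formula for |HN| and |H^2 N^2|,
together with (H ∩ N)^2 ≤ H^2 ∩ N^2, reduces the claim to the hypothesis on H ∩ N. -/
theorem relIndex_squares_le_sup [Finite G] {H N : Subgroup G} [N.Normal]
    (hc : ⁅N, H⁆ ≤ N.squares)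
    (hd : (H ⊓ N).squares.relIndex (H ⊓ N) ≤ N.squares.relIndex N) :
    H.squares.relIndex H ≤ (H ⊔ N).squares.relIndex (H ⊔ N) := by
  have hsup : (H ⊔ N).squares = H.squares ⊔ N.squares := by
    apply le_antisymm
    · rw [squares_le_iff]
      intro x hx
      obtain ⟨h, hh, n, hn, rfl⟩ := mem_sup_of_normal_right.1 hx
      have : (h * n) ^ 2 = h ^ 2 * (⁅h⁻¹, n⁆ * n ^ 2) := by
        simp [commutatorElement_def, sq, mul_assoc]
      rw [this]
      refine mul_mem (mem_sup_left (sq_mem_squares hh)) (mem_sup_right (mul_mem (hc ?_)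
        (sq_mem_squares hn)))
      rw [commutator_comm]
      exact commutator_mem_commutator (inv_mem hh) hn
    · exact sup_le (squares_mono le_sup_left) (squares_mono le_sup_right)
  have e1 := relIndex_mul_card H.squares_le_self
  have e2 := relIndex_mul_card N.squares_le_self
  have e3 := relIndex_mul_card (H ⊔ N).squares_le_self
  have e4 := relIndex_mul_card (H ⊓ N).squares_le_self
  have e5 := card_sup_mul_card_inf H N
  have e6 := card_sup_mul_card_inf H.squares N.squares
  rw [← hsup] at e6
  have e7 : Nat.card (H ⊓ N).squares ≤ Nat.card (H.squares ⊓ N.squares : Subgroup G) :=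
    Nat.card_mono (Set.toFinite _)
      (le_inf (squares_mono inf_le_left) (squares_mono inf_le_right))
  have p1 : 0 < Nat.card (H ⊓ N : Subgroup G) := Nat.card_pos
  have p2 : 0 < Nat.card H.squares := Nat.card_pos
  have p3 : 0 < Nat.card N.squares := Nat.card_pos
  have p4 : 0 < Nat.card (H.squares ⊓ N.squares : Subgroup G) := Nat.card_pos
  have p5 : 0 < Nat.card (H ⊔ N).squares := Nat.card_pos
  generalize (H ⊔ N).squares.relIndex (H ⊔ N) = x at *
  generalize H.squares.relIndex H = y at *
  generalize N.squares.relIndex N = n at *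
  generalize (H ⊓ N).squares.relIndex (H ⊓ N) = q at *
  generalize Nat.card (H ⊔ N : Subgroup G) = M at *
  generalize Nat.card (H ⊓ N : Subgroup G) = Q at *
  generalize Nat.card (H ⊔ N).squares = sM at *
  generalize Nat.card (H ⊓ N).squares = sQ at *
  generalize Nat.card (H.squares ⊓ N.squares : Subgroup G) = sI at *
  generalize Nat.card H.squares = sH at *
  generalize Nat.card N.squares = sN at *
  have k1 : Q ≤ n * sI := e4 ▸ Nat.mul_le_mul hd e7
  have k2 : x * Q = y * (n * sI) := by
    have : (x * Q) * sM = (y * (n * sI)) * sM := by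
      calc (x * Q) * sM = (y * sH) * (n * sN) := by rw [e1, e2, ← e5, ← e3]; ring
        _ = y * n * (sH * sN) := by ring
        _ = _ := by rw [← e6]; ring
    exact Nat.eq_of_mul_eq_mul_right p5 this
  refine Nat.le_of_mul_le_mul_right ?_ p1
  rw [k2]
  exact Nat.mul_le_mul_left y k1

/-- Modulo N = Φ(Φ(G)) the group is abelian, so squaring is a homomorphism G → G/N. It sends H and G
to the images of their squares, whence |G^2 : H^2| ≤ |G : H|. -/
theorem relIndex_squares_le_index_squares_top [Finite G]
    (h : ⁅(⊤ : Subgroup G), ⊤⁆ ≤ (⊤ : Subgroup G).squares.squares) {H : Subgroup G}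
    (hH : (⊤ : Subgroup G).squares ≤ H) :
    H.squares.relIndex H ≤ (⊤ : Subgroup G).squares.index := by
  set N := (⊤ : Subgroup G).squares.squares with hN
  have hcomm : ∀ a b : G ⧸ N, a * b = b * a := by
    intro a b
    induction a using QuotientGroup.induction_on with | _ a
    induction b using QuotientGroup.induction_on with | _ b
    rw [← commutatorElement_eq_one_iff_mul_comm]
    exact (QuotientGroup.eq_one_iff ⁅a, b⁆).2
      (h (commutator_mem_commutator (mem_top a) (mem_top b)))
  let f : G →* G ⧸ N := MonoidHom.mk' (fun g => (QuotientGroup.mk' N g) ^ 2) fun a b => by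
    rw [map_mul, (show Commute _ _ from hcomm _ _).mul_pow]
  have hf : ∀ L : Subgroup G, L.map f = L.squares.map (QuotientGroup.mk' N) := by
    intro L
    apply le_antisymm
    · rintro _ ⟨g, hg, rfl⟩
      exact ⟨g ^ 2, sq_mem_squares hg, map_pow _ _ _⟩
    · rw [map_le_iff_le_comap, squares_le_iff]
      intro g hg
      exact ⟨g, hg, (map_pow _ _ _).symm⟩
  have hNH : N ≤ H.squares := squares_mono hH
  have h1 : H.squares.relIndex (⊤ : Subgroup G).squares ≤ H.index := by
    have e1 := relIndex_map_map f H ⊤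
    rw [hf, hf, relIndex_map_map, QuotientGroup.ker_mk', sup_of_le_left hNH,
      sup_of_le_left (squares_le_self _), top_sup_eq, relIndex_top_right] at e1
    rw [e1]
    exact index_antitone le_sup_left
  have hle : H.squares ≤ (⊤ : Subgroup G).squares := squares_mono le_top
  rw [← relIndex_mul_relIndex _ _ _ hle hH, ← relIndex_mul_index hH, mul_comm]
  exact Nat.mul_le_mul_left _ h1

theorem relIndex_squares_le_of_squares_le [Finite G] {P H : Subgroup G}
    (h : ⁅P, P⁆ ≤ P.squares.squares) (h1 : P.squares ≤ H) (h2 : H ≤ P) :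
    H.squares.relIndex H ≤ P.squares.relIndex P := by
  have hP : (⊤ : Subgroup P).map P.subtype = P := by
    rw [← MonoidHom.range_eq_map, range_subtype]
  have hH : (H.subgroupOf P).map P.subtype = H := by
    rw [subgroupOf_map_subtype, inf_of_le_left h2]
  have key := relIndex_squares_le_index_squares_top (G := P) (H := H.subgroupOf P)
    (by rw [← map_le_map_iff_of_injective P.subtype_injective]
        simpa only [map_commutator, map_squares, hP] using h)
    (by rw [← map_le_map_iff_of_injective P.subtype_injective]
        simpa only [map_squares, hP, hH] using h1)
  rw [← relIndex_top_right, ← relIndex_map_map_of_injective _ _ P.subtype_injective,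
    ← relIndex_map_map_of_injective _ _ P.subtype_injective, map_squares, map_squares, hP, hH] at key
  exact key

theorem eq_bot_of_squares_eq [Finite G] (hG : IsPGroup 2 G) {P : Subgroup G}
    (h : P.squares = P) : P = ⊥ := by
  have hP : (⊤ : Subgroup P).map P.subtype = P := by
    rw [← MonoidHom.range_eq_map, range_subtype]
  have h1 : (⊤ : Subgroup P).squares = ⊤ := by
    apply map_injective P.subtype_injective
    rw [map_squares, hP, h]
  have h2 : (⊥ : Subgroup P) = ⊤ :=
    eq_top_of_sup_squares_top (hG.to_subgroup P) (by rw [h1, bot_sup_eq])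
  rw [← hP, ← h2, map_bot]

/-- A subgroup of a powerful `2`-group `P` needs no more generators than `P`. -/
theorem relIndex_squares_le_of_commutator_le [Finite G] (hG : IsPGroup 2 G) (P : Subgroup G)
    [P.Normal] (h : ⁅P, P⁆ ≤ P.squares.squares) {Q : Subgroup G} (hQ : Q ≤ P) :
    Q.squares.relIndex Q ≤ P.squares.relIndex P := by
  induction hn : Nat.card P using Nat.strong_induction_on generalizing P Q with
  | _ n ih =>
  by_cases hPs : P.squares = P
  · obtain rfl := eq_bot_of_squares_eq hG hPs
    rw [le_bot_iff.1 hQ]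
  · have hlt : P.squares < P := lt_of_le_of_ne P.squares_le_self hPs
    have hK := ih _ (hn ▸ Set.ncard_lt_ncard hlt (Set.toFinite _)) P.squares
      (commutator_squares_le_of_commutator_le hG h) (inf_le_right : Q ⊓ P.squares ≤ _) rfl
    -- Pass from Q to QP^2, using induction for Q ∩ P^2 in the powerful group P^2, and then from
    -- QP^2 to P.
    have h1 := relIndex_squares_le_sup (H := Q) (N := P.squares)
      ((commutator_mono P.squares_le_self hQ).trans h) hK
    exact h1.trans (relIndex_squares_le_of_squares_le h le_sup_right (sup_le hQ P.squares_le_self))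

end Subgroup

/-! ### Invariant sections and d-maximal groups. -/

namespace Subgroup

variable {G : Type*} [Group G]

theorem smul_mem_commutator {A : Type*} [Group A] [MulDistribMulAction A G] {H K : Subgroup G}
    (hH : ∀ a : A, ∀ h ∈ H, a • h ∈ H) (hK : ∀ a : A, ∀ h ∈ K, a • h ∈ K) (a : A) :
    ∀ x ∈ ⁅H, K⁆, a • x ∈ ⁅H, K⁆ := by
  intro x hx
  have : (⁅H, K⁆).map (MulDistribMulAction.toMonoidHom G a) ≤ ⁅H, K⁆ := by
    rw [map_commutator]
    apply commutator_mono
    · rintro _ ⟨y, hy, rfl⟩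
      exact hH a y hy
    · rintro _ ⟨y, hy, rfl⟩
      exact hK a y hy
  exact this ⟨x, hx, rfl⟩

theorem smul_mem_sup {A : Type*} [Group A] [MulDistribMulAction A G] {H K : Subgroup G}
    (hH : ∀ a : A, ∀ h ∈ H, a • h ∈ H) (hK : ∀ a : A, ∀ h ∈ K, a • h ∈ K) (a : A) :
    ∀ x ∈ H ⊔ K, a • x ∈ H ⊔ K := by
  intro x hx
  have : (H ⊔ K).map (MulDistribMulAction.toMonoidHom G a) ≤ H ⊔ K := by
    rw [map_sup]
    apply sup_le_sup
    · rintro _ ⟨y, hy, rfl⟩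
      exact hH a y hy
    · rintro _ ⟨y, hy, rfl⟩
      exact hK a y hy
  exact this ⟨x, hx, rfl⟩

/-- A `p`-group acting on a `p`-group fixes a nontrivial coset of `T` inside `R`. -/
theorem exists_smul_mem_leftCoset [Finite G] {p : ℕ} [Fact p.Prime] {A : Type*} [Group A] [Finite A]
    [MulDistribMulAction A G] (hG : IsPGroup p G) (hA : IsPGroup p A) {T R : Subgroup G} [T.Normal]
    (hTA : ∀ a : A, ∀ h ∈ T, a • h ∈ T) (hRA : ∀ a : A, ∀ h ∈ R, a • h ∈ R) (hTR : ¬ R ≤ T) :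
    ∃ x ∈ R, x ∉ T ∧ ∀ a : A, x⁻¹ * a • x ∈ T := by
  let _ : MulAction.QuotientAction A T := ⟨fun a x y h => by simpa using hTA a _ h⟩
  let X : SubMulAction A (G ⧸ T) :=
    { carrier := (R.map (QuotientGroup.mk' T) : Set (G ⧸ T))
      smul_mem' := by
        rintro a _ ⟨r, hr, rfl⟩
        exact ⟨a • r, hRA a r hr, rfl⟩ }
  have hX : Nat.card X = Nat.card (R.map (QuotientGroup.mk' T)) := rfl
  have hdvd : p ∣ Nat.card X := by
    rw [hX]
    refine ((hG.to_subgroup R).map (QuotientGroup.mk' T)).card_eq_or_dvd.resolve_left ?_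
    rw [card_eq_one, map_eq_bot_iff, QuotientGroup.ker_mk']
    exact hTR
  let o : X := ⟨QuotientGroup.mk' T 1, 1, R.one_mem, rfl⟩
  have ho : o ∈ MulAction.fixedPoints A X := fun a => Subtype.ext
    (congrArg (QuotientGroup.mk (s := T)) (smul_one a))
  obtain ⟨⟨_, x, hx, rfl⟩, hb, hne⟩ :=
    hA.exists_fixed_point_of_prime_dvd_card_of_fixed_point X hdvd ho
  refine ⟨x, hx, fun hxT => hne ?_, fun a => ?_⟩
  · apply Subtype.ext
    change QuotientGroup.mk' T 1 = QuotientGroup.mk' T x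
    rw [map_one]
    exact ((QuotientGroup.eq_one_iff x).2 hxT).symm
  · have h1 : (QuotientGroup.mk (a • x) : G ⧸ T) = QuotientGroup.mk x :=
      congrArg Subtype.val (hb a)
    exact QuotientGroup.eq.1 h1.symm

/-- If `P` is centralized by `G` up to a central subgroup of order at most `2`, then the
centralizer of `P` has index at most that of the center in `P`. -/
theorem index_centralizer_le [Finite G] {P : Subgroup G} {z : G} (hz : z ^ 2 = 1)
    (hzc : z ∈ center G) (h : ∀ p ∈ P, ∀ g : G, ⁅p, g⁆ = 1 ∨ ⁅p, g⁆ = z) :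
    (centralizer (P : Set G)).index ≤ (center G).relIndex P := by
  -- Take B maximal with the inequality. Adjoining p ∈ P \ B at least doubles B, while the
  -- centralizer of p has index at most 2, so the inequality would persist.
  have hfin : {B : Subgroup G | center G ⊓ P ≤ B ∧ B ≤ P ∧
      (centralizer (B : Set G)).index ≤ (center G ⊓ P).relIndex B}.Finite := Set.toFinite _
  obtain ⟨B, ⟨hB1, hB2, hB3⟩, hmax⟩ := hfin.exists_maximal ⟨center G ⊓ P, le_rfl, inf_le_right, by
    have : centralizer ((center G ⊓ P : Subgroup G) : Set G) = ⊤ := by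
      rw [eq_top_iff]
      intro g _
      rw [mem_centralizer_iff]
      intro c hc
      exact (mem_center_iff.1 hc.1 g).symm
    rw [this, index_top, relIndex_self]⟩
  by_cases hBP : B = P
  · subst hBP
    rwa [inf_relIndex_right] at hB3
  exfalso
  obtain ⟨p, hp, hpB⟩ := SetLike.exists_of_lt (lt_of_le_of_ne hB2 hBP)
  have hB' : B < B ⊔ zpowers p := lt_of_le_of_ne le_sup_left fun e =>
    hpB (e ▸ (le_sup_right : zpowers p ≤ _) (mem_zpowers p))
  have hle : B ⊔ zpowers p ≤ P := sup_le hB2 (by rwa [zpowers_le])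
  refine hB'.not_ge (hmax ⟨hB1.trans hB'.le, hle, ?_⟩ hB'.le)
  have hcent : centralizer ((B ⊔ zpowers p : Subgroup G) : Set G) =
      centralizer (B : Set G) ⊓ centralizer {p} := by
    apply le_antisymm
    · refine le_inf (centralizer_le ?_) (centralizer_le ?_)
      · exact (le_sup_left : B ≤ B ⊔ zpowers p)
      · rw [Set.singleton_subset_iff]
        exact (le_sup_right : zpowers p ≤ B ⊔ zpowers p) (mem_zpowers p)
    · rw [le_centralizer_iff]
      refine sup_le ?_ ?_
      · rw [le_centralizer_iff]; exact inf_le_left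
      · rw [zpowers_le, mem_centralizer_iff]
        rintro g ⟨_, hg⟩
        exact (mem_centralizer_singleton_iff.1 hg)
  have hp2 : (centralizer ({p} : Set G)).index ≤ 2 := by
    apply Nat.le_of_dvd two_pos
    rw [index_dvd_two_iff]
    have hcm : ∀ g, g ∈ centralizer ({p} : Set G) ↔ ⁅p, g⁆ = 1 := fun g => by
      rw [mem_centralizer_singleton_iff, commutatorElement_eq_one_iff_mul_comm, eq_comm]
    by_cases hex : ∃ a, a ∉ centralizer ({p} : Set G)
    · obtain ⟨a, ha⟩ := hex
      refine ⟨a, fun b => ?_⟩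
      by_cases hb : b ∈ centralizer ({p} : Set G)
      · exact Or.inr hb
      left
      rw [hcm] at ha hb ⊢
      have ha' := (h p hp a).resolve_left ha
      have hb' := (h p hp b).resolve_left hb
      have : ⁅p, b * a⁆ = ⁅p, b⁆ * (b * ⁅p, a⁆ * b⁻¹) := by
        simp [commutatorElement_def, mul_assoc]
      rw [this, ha', hb', mem_center_iff.1 hzc b, mul_inv_cancel_right, ← sq, hz]
    · push Not at hex
      exact ⟨1, fun b => Or.inr (hex b)⟩
  have h2 : 2 ≤ B.relIndex (B ⊔ zpowers p) := by
    have h1 : B.relIndex (B ⊔ zpowers p) ≠ 1 := fun e => hB'.not_ge (relIndex_eq_one.1 e)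
    have h0 : B.relIndex (B ⊔ zpowers p) ≠ 0 := index_ne_zero_of_finite
    omega
  rw [hcent, ← relIndex_mul_relIndex _ _ _ hB1 hB'.le]
  exact index_inf_le.trans (Nat.mul_le_mul hB3 (hp2.trans h2))

/-- In a `2`-group acted on by a `2`-group, an invariant normal subgroup `R` not contained in the
invariant normal subgroup `S` of `R` has a central invariant quotient of order `2`. -/
theorem exists_invariant_normal_of_lt [Finite G] {A : Type*} [Group A] [Finite A]
    [MulDistribMulAction A G] (hG : IsPGroup 2 G) (hA : IsPGroup 2 A) {S R : Subgroup G}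
    [R.Normal] [hSn : S.Normal] (hSA : ∀ a : A, ∀ h ∈ S, a • h ∈ S)
    (hRA : ∀ a : A, ∀ h ∈ R, a • h ∈ R) (hSR : S < R) (hRS : R.squares ≤ S) :
    ∃ T : Subgroup G, T.Normal ∧ (∀ a : A, ∀ h ∈ T, a • h ∈ T) ∧ S ≤ T ∧ T < R ∧ ⁅R, ⊤⁆ ≤ T ∧
      ∃ x ∈ R, ∀ r ∈ R, r ∈ T ∨ x⁻¹ * r ∈ T := by
  have : Fact (Nat.Prime 2) := ⟨Nat.prime_two⟩
  have := hG.isNilpotent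
  have hfin : {T : Subgroup G | T.Normal ∧ (∀ a : A, ∀ h ∈ T, a • h ∈ T) ∧ S ≤ T ∧ T < R}.Finite :=
    Set.toFinite _
  obtain ⟨T, ⟨hT, hTA, hST, hTR⟩, hmax⟩ := hfin.exists_maximal ⟨S, hSn, hSA, le_rfl, hSR⟩
  -- By nilpotency [R, G]T is smaller than R, so maximality of T absorbs it.
  have hRT : ⁅R, ⊤⁆ ≤ T := by
    have hlt : ⁅R, ⊤⁆ ⊔ T < R := by
      refine lt_of_le_of_ne (sup_le (commutator_le_left R ⊤) hTR.le) fun e => ?_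
      exact hTR.not_ge (le_of_le_commutator_top_sup e.ge)
    exact le_sup_left.trans (hmax ⟨inferInstance,
      smul_mem_sup (smul_mem_commutator hRA fun _ _ _ => mem_top _) hTA,
      hST.trans le_sup_right, hlt⟩ le_sup_right)
  obtain ⟨x, hx, hxT, hxA⟩ := exists_smul_mem_leftCoset hG hA hTA hRA hTR.not_ge
  have hxR : T ⊔ zpowers x ≤ R := sup_le hTR.le (by rwa [zpowers_le])
  have hxmem : x ∈ T ⊔ zpowers x := (le_sup_right : zpowers x ≤ _) (mem_zpowers x)
  -- T⟨x⟩ is normal since x is central modulo T, and invariant since the coset xT is fixed; by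
  -- maximality of T it equals R.
  have hnorm : (T ⊔ zpowers x).Normal := by
    constructor
    intro y hy g
    have : g * y * g⁻¹ = ⁅y, g⁆⁻¹ * y := by simp [commutatorElement_def, mul_assoc]
    rw [this]
    exact mul_mem (inv_mem (le_sup_left (a := T) (hRT (commutator_mem_commutator (hxR hy)
      (mem_top g))))) hy
  have hinv : ∀ a : A, ∀ h ∈ T ⊔ zpowers x, a • h ∈ T ⊔ zpowers x := by
    intro a h hh
    have hle : T ⊔ zpowers x ≤ (T ⊔ zpowers x).comap (MulDistribMulAction.toMonoidHom G a) := by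
      refine sup_le (fun t ht => mem_sup_left (hTA a t ht)) ?_
      rw [zpowers_le, mem_comap]
      have := mul_mem hxmem (le_sup_left (a := T) (b := zpowers x) (hxA a))
      rwa [mul_inv_cancel_left] at this
    exact hle hh
  have hR : T ⊔ zpowers x = R := by
    by_contra hne
    exact hxT (hmax ⟨hnorm, hinv, hST.trans le_sup_left, lt_of_le_of_ne hxR hne⟩ le_sup_left hxmem)
  refine ⟨T, hT, hTA, hST, hTR, hRT, x, hx, fun r hr => ?_⟩
  rw [← hR, sup_comm] at hr
  obtain ⟨_, ⟨k, rfl⟩, t, ht, rfl⟩ := mem_sup_of_normal_right.1 hr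
  have hx2 : x ^ (2 : ℤ) ∈ T := by
    rw [zpow_ofNat]; exact hST (hRS (sq_mem_squares hx))
  rcases Int.even_or_odd' k with ⟨m, rfl | rfl⟩
  · left
    refine mul_mem ?_ ht
    change x ^ (2 * m) ∈ T
    rw [zpow_mul]
    exact zpow_mem hx2 m
  · right
    change x⁻¹ * (x ^ (2 * m + 1) * t) ∈ T
    rw [← mul_assoc, add_comm, zpow_add, zpow_one, inv_mul_cancel_left, zpow_mul]
    exact mul_mem (zpow_mem hx2 m) ht

end Subgroup

open Subgroup

/-- In a `d`-maximal `2`-group, the Frattini subgroup is central modulo its own Frattini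
subgroup. -/
theorem IsDMaximalFor.commutator_squares_le {A G : Type*} [Group G] [Finite G] [Group A] [Finite A]
    [MulDistribMulAction A G] (hG : IsPGroup 2 G) (hA : IsPGroup 2 A) (hd : IsDMaximalFor A G) :
    ⁅(⊤ : Subgroup G).squares, ⊤⁆ ≤ (⊤ : Subgroup G).squares.squares := by
  set P := (⊤ : Subgroup G).squares with hP
  by_contra hnot
  have hPA : ∀ a : A, ∀ h ∈ P, a • h ∈ P := smul_mem_squares fun _ _ _ => mem_top _
  have hSA : ∀ a : A, ∀ h ∈ P.squares, a • h ∈ P.squares := smul_mem_squares hPA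
  have hRP : ⁅P, ⊤⁆ ⊔ P.squares ≤ P := sup_le (commutator_le_left P ⊤) P.squares_le_self
  obtain ⟨T, hT, hTA, hST, hTR, hRT, x, hx, hxT⟩ :=
    exists_invariant_normal_of_lt (A := A) (S := P.squares) (R := ⁅P, ⊤⁆ ⊔ P.squares) hG hA hSA
      (smul_mem_sup (smul_mem_commutator hPA fun _ _ _ => mem_top _) hSA)
      (lt_of_le_of_ne le_sup_right fun e => hnot (le_sup_left.trans e.ge)) (squares_mono hRP)
  let π := QuotientGroup.mk' T
  have hπ : ∀ g, π g = 1 ↔ g ∈ T := fun g => QuotientGroup.eq_one_iff g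
  have hsurj : Function.Surjective π := QuotientGroup.mk'_surjective T
  -- Modulo T, commutators of P with G take only the values 1 and x, so they pair P/(Z ∩ P) with
  -- G/C. The subgroup C will contradict d-maximality.
  set C := (centralizer (P.map π : Set (G ⧸ T))).comap π with hC
  set Z := (center (G ⧸ T)).comap π with hZ
  have hCmem : ∀ g, g ∈ C ↔ ∀ p ∈ P, ⁅g, p⁆ ∈ T := by
    intro g
    rw [hC, mem_comap, mem_centralizer_iff]
    constructor
    · intro h p hp
      rw [← hπ, map_commutatorElement, commutatorElement_eq_one_iff_mul_comm]
      exact (h _ (mem_map_of_mem π hp)).symm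
    · rintro h _ ⟨p, hp, rfl⟩
      have := (hπ _).2 (h p hp)
      rw [map_commutatorElement, commutatorElement_eq_one_iff_mul_comm] at this
      exact this.symm
  have hZmem : ∀ g, g ∈ Z ↔ ∀ y, ⁅g, y⁆ ∈ T := by
    intro g
    rw [hZ, mem_comap, mem_center_iff]
    constructor
    · intro h y
      rw [← hπ, map_commutatorElement, commutatorElement_eq_one_iff_mul_comm]
      exact (h _).symm
    · intro h q
      obtain ⟨y, rfl⟩ := hsurj q
      have := (hπ _).2 (h y)
      rw [map_commutatorElement, commutatorElement_eq_one_iff_mul_comm] at this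
      exact this.symm
  have hCA : ∀ a : A, ∀ h ∈ C, a • h ∈ C := by
    intro a h hh
    rw [hCmem] at hh ⊢
    intro p hp
    have := hTA a _ (hh _ (hPA a⁻¹ p hp))
    simpa [commutatorElement_def, smul_mul', smul_inv'] using this
  have hCtop : C ≠ ⊤ := by
    intro e
    apply hTR.not_ge
    refine sup_le ?_ hST
    rw [commutator_comm, commutator_le]
    intro g _ p hp
    exact (hCmem g).1 (e ▸ mem_top g) p hp
  have hPC : P ≤ C := fun p hp => (hCmem p).2 fun q hq =>
    hST (P.commutator_le_squares (commutator_mem_commutator hp hq))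
  have hsC : C.squares ≤ Z ⊓ P := by
    refine le_inf ?_ (squares_mono le_top)
    rw [squares_le_iff]
    intro g hg
    rw [hZmem]
    intro y
    have hw : ⁅g, y⁆ ∈ P := (⊤ : Subgroup G).commutator_le_squares
      (commutator_mem_commutator (mem_top g) (mem_top y))
    rw [commutatorElement_sq_left]
    exact mul_mem ((hCmem g).1 hg _ hw) (hST (sq_mem_squares hw))
  have hcount : C.index ≤ (Z ⊓ P).relIndex P := by
    rw [inf_relIndex_right, hZ, relIndex_comap, hC, index_comap_of_surjective _ hsurj]
    apply index_centralizer_le (z := π x)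
    · rw [← map_pow, hπ]
      exact hST (sq_mem_squares (hRP hx))
    · have : x ∈ Z := (hZmem x).2 fun y => hRT (commutator_mem_commutator hx (mem_top y))
      exact this
    · rintro _ ⟨p, hp, rfl⟩ q
      obtain ⟨g, rfl⟩ := hsurj q
      rw [← map_commutatorElement]
      rcases hxT _ (mem_sup_left (commutator_mem_commutator hp (mem_top g))) with h | h
      · exact Or.inl ((hπ _).2 h)
      · right
        have := (hπ _).2 h
        rw [map_mul, map_inv, inv_mul_eq_one] at this
        exact this.symm
  -- |C : C^2| ≥ |C : P| |P : Z ∩ P| ≥ |C : P| |G : C| = |G : P|, that is, d(C) ≥ d(G).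
  have h1 : P.index ≤ C.squares.relIndex C := by
    rw [← relIndex_mul_relIndex _ _ _ hsC (inf_le_right.trans hPC),
      ← relIndex_mul_relIndex _ _ _ (inf_le_right : Z ⊓ P ≤ P) hPC, ← relIndex_mul_index hPC,
      mul_comm (P.relIndex C), ← mul_assoc]
    refine Nat.mul_le_mul_right _ (hcount.trans ?_)
    exact Nat.le_mul_of_pos_left _ (Nat.pos_of_ne_zero index_ne_zero_of_finite)
  rw [relIndex_squares hG, hP, index_squares_top hG] at h1
  exact (hd C hCA hCtop).not_ge ((Nat.pow_le_pow_iff_right (by norm_num)).1 h1)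

/-! ### Lifting d-maximality. -/

theorem powSubgroup_four_le (G : Type*) [Group G] :
    powSubgroup G 4 ≤ (⊤ : Subgroup G).squares.squares := by
  unfold powSubgroup
  rw [closure_le]
  rintro _ ⟨x, rfl⟩
  have : x ^ 4 = (x ^ 2) ^ 2 := by rw [← pow_mul]
  change x ^ 4 ∈ _
  rw [this]
  exact sq_mem_squares (sq_mem_squares (mem_top x))

/-- If `G ⧸ G ^ 4` is `d`-maximal, every proper invariant subgroup of `G` needs at most as many
generators as some proper invariant subgroup of `G ⧸ G ^ 4`. -/
theorem IsDMaximalFor.exists_rank_le {A G : Type*} [Group G] [Finite G] [Group A] [Finite A]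
    [MulDistribMulAction A G] (hG : IsPGroup 2 G) (hA : IsPGroup 2 A)
    (hd : IsDMaximalFor A (G ⧸ powSubgroup G 4)) {H : Subgroup G}
    (hH : ∀ a : A, ∀ h ∈ H, a • h ∈ H) (hne : H ≠ ⊤) :
    ∃ K : Subgroup (G ⧸ powSubgroup G 4), (∀ a : A, ∀ k ∈ K, a • k ∈ K) ∧ K ≠ ⊤ ∧
      Group.rank H ≤ Group.rank K := by
  set N := powSubgroup G 4 with hN
  set P := (⊤ : Subgroup G).squares with hP
  let π := QuotientGroup.mk' N
  have hsurj : Function.Surjective π := QuotientGroup.mk'_surjective N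
  have hker : π.ker = N := QuotientGroup.ker_mk' N
  have hNS : N ≤ P.squares := powSubgroup_four_le G
  have hQ : IsPGroup 2 (G ⧸ N) := hG.to_quotient N
  have hmapP : (⊤ : Subgroup (G ⧸ N)).squares = P.map π := by
    rw [hP, map_squares, map_top_of_surjective π hsurj]
  -- The inclusion pulls back without loss because `P.squares` contains the kernel G^4.
  have hPc : ⁅P, ⊤⁆ ≤ P.squares := by
    have := hd.commutator_squares_le hQ hA
    rw [hmapP, ← map_top_of_surjective π hsurj, ← map_commutator, ← map_squares,
      Subgroup.map_le_map_iff, hker, sup_of_le_left hNS] at this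
    exact this
  have : Fact (Nat.Prime 2) := ⟨Nat.prime_two⟩
  have := hG.isNilpotent
  have hpow : ⁅P, P⁆ ≤ P.squares.squares := commutator_squares_top_le hPc
  have h1 : H.squares.relIndex H ≤ (H ⊔ P).squares.relIndex (H ⊔ P) :=
    relIndex_squares_le_sup ((commutator_mono le_rfl le_top).trans hPc)
      (relIndex_squares_le_of_commutator_le hG P hpow inf_le_right)
  have hNM : N ≤ (H ⊔ P).squares := hNS.trans (squares_mono le_sup_right)
  have hM : H ⊔ P ≠ ⊤ := fun e => hne (eq_top_of_sup_squares_top hG e)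
  have hMA := smul_mem_sup hH (smul_mem_squares (A := A) (H := (⊤ : Subgroup G))
    fun _ _ _ => mem_top _)
  refine ⟨(H ⊔ P).map π, ?_, ?_, ?_⟩
  · rintro a _ ⟨g, hg, rfl⟩
    exact ⟨a • g, hMA a g hg, rfl⟩
  · intro e
    apply hM
    have := congrArg (comap π) e
    rwa [comap_map_eq, hker, comap_top, sup_of_le_left (hNM.trans (squares_le_self _))] at this
  · have h2 : ((H ⊔ P).map π).squares.relIndex ((H ⊔ P).map π) =
        (H ⊔ P).squares.relIndex (H ⊔ P) := by
      rw [← map_squares, relIndex_map_map, hker, sup_of_le_left hNM,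
        sup_of_le_left (hNM.trans (squares_le_self _))]
    rw [← h2, relIndex_squares hG, relIndex_squares hQ] at h1
    exact (Nat.pow_le_pow_iff_right (by norm_num)).1 h1

theorem IsDMaximalFor.of_quotient_powSubgroup {A G : Type*} [Group G] [Finite G] [Group A]
    [Finite A] [MulDistribMulAction A G] (hG : IsPGroup 2 G) (hA : IsPGroup 2 A)
    (hd : IsDMaximalFor A (G ⧸ powSubgroup G 4)) : IsDMaximalFor A G := by
  intro H hH hne
  obtain ⟨K, hK, hKt, hle⟩ := hd.exists_rank_le hG hA hH hne
  exact (hle.trans_lt (hd K hK hKt)).trans_le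
    (Group.rank_le_of_surjective (QuotientGroup.mk' _) (QuotientGroup.mk'_surjective _))

/-! ### Metacyclic groups and two-generated groups. -/

theorem IsMetacyclic.of_surjective {X Y : Type*} [Group X] [Group Y] (h : IsMetacyclic X)
    (f : X →* Y) (hf : Function.Surjective f) : IsMetacyclic Y := by
  obtain ⟨N, hN, hc, hq⟩ := h
  have hN' : (N.map f).Normal := hN.map f hf
  refine ⟨N.map f, hN', isCyclic_of_surjective _ (f.subgroupMap_surjective N), ?_⟩
  exact isCyclic_of_surjective (QuotientGroup.map N (N.map f) f (le_comap_map f N))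
    (QuotientGroup.map_surjective_of_surjective _ _ _
      ((QuotientGroup.mk'_surjective _).comp hf) _)

theorem isMetacyclic_iff {X : Type*} [Group X] :
    IsMetacyclic X ↔ ∃ a b : X, (zpowers a).Normal ∧ zpowers a ⊔ zpowers b = ⊤ := by
  constructor
  · rintro ⟨N, hN, hc, hq⟩
    obtain ⟨⟨a, haN⟩, ha⟩ := isCyclic_iff_exists_zpowers_eq_top.1 hc
    obtain rfl : zpowers a = N := by
      have := congrArg (map N.subtype) ha
      rwa [MonoidHom.map_zpowers, ← MonoidHom.range_eq_map, range_subtype] at this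
    obtain ⟨q, hq⟩ := isCyclic_iff_exists_zpowers_eq_top.1 hq
    obtain ⟨b, rfl⟩ := QuotientGroup.mk'_surjective _ q
    refine ⟨a, b, hN, ?_⟩
    rw [← MonoidHom.map_zpowers] at hq
    have := congrArg (comap (QuotientGroup.mk' _)) hq
    rwa [comap_map_eq, QuotientGroup.ker_mk', comap_top, sup_comm] at this
  · rintro ⟨a, b, hN, hab⟩
    refine ⟨zpowers a, hN, inferInstance, isCyclic_iff_exists_zpowers_eq_top.2
      ⟨QuotientGroup.mk' _ b, ?_⟩⟩
    have := congrArg (map (QuotientGroup.mk' (zpowers a))) hab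
    rwa [Subgroup.map_sup, QuotientGroup.map_mk'_self, bot_sup_eq, MonoidHom.map_zpowers,
      map_top_of_surjective _ (QuotientGroup.mk'_surjective _)] at this

theorem IsMetacyclic.rank_le {X : Type*} [Group X] [Finite X] (h : IsMetacyclic X) :
    Group.rank X ≤ 2 := by
  classical
  obtain ⟨a, b, -, hab⟩ := isMetacyclic_iff.1 h
  refine (Group.rank_le (S := {a, b}) ?_).trans Finset.card_le_two
  rw [eq_top_iff, ← hab]
  refine sup_le ?_ ?_ <;> rw [zpowers_le] <;> exact subset_closure (by simp)

theorem exists_zpowers_sup_eq_top {X : Type*} [Group X] [Finite X] (h : Group.rank X ≤ 2) :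
    ∃ x y : X, zpowers x ⊔ zpowers y = ⊤ := by
  classical
  obtain ⟨S, hS, hSt⟩ := Group.rank_spec X
  have key : ∀ x y : X, S ⊆ {x, y} → zpowers x ⊔ zpowers y = ⊤ := by
    intro x y hxy
    rw [eq_top_iff, ← hSt, closure_le]
    intro s hs
    rcases Finset.mem_insert.1 (hxy hs) with rfl | hs
    · exact mem_sup_left (mem_zpowers s)
    · rw [Finset.mem_singleton.1 hs]; exact mem_sup_right (mem_zpowers y)
  rw [← hS] at h
  rcases (by omega : S.card = 0 ∨ S.card = 1 ∨ S.card = 2) with h | h | h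
  · rw [Finset.card_eq_zero] at h
    exact ⟨1, 1, key 1 1 (by simp [h])⟩
  · obtain ⟨a, rfl⟩ := Finset.card_eq_one.1 h
    exact ⟨a, a, key a a (by simp)⟩
  · obtain ⟨a, b, -, rfl⟩ := Finset.card_eq_two.1 h
    exact ⟨a, b, key a b (by simp)⟩

/-! ### 2-groups all of whose subgroups are two-generated. -/

namespace Subgroup

variable {G : Type*} [Group G]

/-- Modulo D the group is generated by central elements and one further element, so it is abelian.
-/
theorem commutator_top_le_of_sup_zpowers {N : Subgroup G} {b : G} (h : N ⊔ zpowers b = ⊤)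
    {D : Subgroup G} [D.Normal] (hN : ⁅N, ⊤⁆ ≤ D) : ⁅(⊤ : Subgroup G), ⊤⁆ ≤ D := by
  let π := QuotientGroup.mk' D
  have hsurj : Function.Surjective π := QuotientGroup.mk'_surjective D
  have hNc : N ≤ (center (G ⧸ D)).comap π := by
    intro n hn
    rw [mem_comap, mem_center_iff]
    intro q
    obtain ⟨g, rfl⟩ := hsurj q
    have : π ⁅n, g⁆ = 1 := (QuotientGroup.eq_one_iff _).2
      (hN (commutator_mem_commutator hn (mem_top g)))
    rw [map_commutatorElement, commutatorElement_eq_one_iff_mul_comm] at this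
    exact this.symm
  have hb : b ∈ (center (G ⧸ D)).comap π := by
    have hle : N ⊔ zpowers b ≤ (centralizer {π b}).comap π := by
      refine sup_le (hNc.trans (comap_mono (center_le_centralizer _))) ?_
      rw [zpowers_le, mem_comap, mem_centralizer_singleton_iff]
    rw [mem_comap, mem_center_iff]
    intro q
    obtain ⟨g, rfl⟩ := hsurj q
    have := hle (h ▸ mem_top g)
    rw [mem_comap, mem_centralizer_singleton_iff] at this
    exact this
  have htop : N ⊔ zpowers b ≤ (center (G ⧸ D)).comap π := sup_le hNc (by rwa [zpowers_le])
  rw [h] at htop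
  rw [commutator_le]
  intro g _ k _
  have := mem_center_iff.1 (htop (mem_top g)) (π k)
  rw [← QuotientGroup.eq_one_iff]
  change π ⁅g, k⁆ = 1
  rw [map_commutatorElement, commutatorElement_eq_one_iff_mul_comm]
  exact this.symm

end Subgroup

/-- Let N = ⟨a⟩⟨z⟩ be the preimage of the cyclic normal subgroup. Then G' ≤ [N, G] and [N, G, G] ≤
N^2 ≤ ⟨a⟩, so the subgroup assumed to contain z lies in ⟨a⟩. Hence N = ⟨a⟩ is already cyclic. -/
theorem isMetacyclic_of_quotient_zpowers {G : Type*} [Group G] {z : G} (hz : z ∈ center G)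
    (hz2 : z ^ 2 = 1) [(zpowers z).Normal]
    (hzR : z ∈ ⁅_root_.commutator G, (⊤ : Subgroup G)⁆ ⊔ (_root_.commutator G).squares)
    (h : IsMetacyclic (G ⧸ zpowers z)) : IsMetacyclic G := by
  set Z := zpowers z with hZ
  let π := QuotientGroup.mk' Z
  obtain ⟨q, r, hq, hqr⟩ := isMetacyclic_iff.1 h
  obtain ⟨a, rfl⟩ := QuotientGroup.mk'_surjective Z q
  obtain ⟨b, rfl⟩ := QuotientGroup.mk'_surjective Z r
  rw [← MonoidHom.map_zpowers] at hq hqr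
  rw [← MonoidHom.map_zpowers] at hqr
  set N := zpowers a ⊔ Z with hN
  have hNn : N.Normal := by
    have := hq.comap π
    rwa [comap_map_eq, QuotientGroup.ker_mk'] at this
  have hNb : N ⊔ zpowers b = ⊤ := by
    have := congrArg (comap π) hqr
    rw [← Subgroup.map_sup, comap_map_eq, QuotientGroup.ker_mk', comap_top] at this
    rw [← this, hN, sup_right_comm]
  have hcz : ∀ g, g * z = z * g := fun g => mem_center_iff.1 hz g
  have hmem : ∀ n ∈ N, ∃ i j : ℤ, n = a ^ i * z ^ j := by
    intro n hn
    obtain ⟨_, ⟨i, rfl⟩, _, ⟨j, rfl⟩, rfl⟩ := mem_sup_of_normal_right.1 hn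
    exact ⟨i, j, rfl⟩
  have haN : a ∈ N := mem_sup_left (mem_zpowers a)
  have hcomm : ∀ i j : ℤ, Commute (a ^ i) (z ^ j) := fun i j =>
    (show Commute a z from hcz a).zpow_zpow i j
  have hsq : N.squares ≤ zpowers a := by
    rw [squares_le_iff]
    intro n hn
    obtain ⟨i, j, rfl⟩ := hmem n hn
    rw [(hcomm i j).mul_pow, ← zpow_natCast (z ^ j), zpow_comm, zpow_natCast, hz2, one_zpow,
      mul_one]
    exact pow_mem (zpow_mem (mem_zpowers a) i) 2
  set L := Z ⊔ N.squares with hL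
  have haL : a ^ (2 : ℤ) ∈ L := by
    rw [zpow_ofNat]; exact mem_sup_right (sq_mem_squares haN)
  have hor : ∀ n ∈ N, n ∈ L ∨ a⁻¹ * n ∈ L := by
    intro n hn
    obtain ⟨i, j, rfl⟩ := hmem n hn
    have hzj : z ^ j ∈ L := mem_sup_left (zpow_mem (mem_zpowers z) j)
    rcases Int.even_or_odd' i with ⟨m, rfl | rfl⟩
    · left
      rw [zpow_mul]
      exact mul_mem (zpow_mem haL m) hzj
    · right
      rw [← mul_assoc, add_comm, zpow_add, zpow_one, inv_mul_cancel_left, zpow_mul]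
      exact mul_mem (zpow_mem haL m) hzj
  -- L is normal of index at most 2 in N, so N/L is central.
  have hNL : ⁅N, ⊤⁆ ≤ L := by
    rw [commutator_le]
    intro n hn g _
    have hLn : L.Normal := inferInstance
    have e : ⁅n, g⁆ = n * (g * n * g⁻¹)⁻¹ := by simp [commutatorElement_def, mul_assoc]
    have hn' := hNn.conj_mem n hn g
    rw [e]
    rcases hor n hn with h1 | h1
    · exact mul_mem h1 (inv_mem (hLn.conj_mem n h1 g))
    · rcases hor _ hn' with h2 | h2
      · have h3 : n ∈ L := by
          have := hLn.conj_mem _ h2 g⁻¹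
          simpa [mul_assoc] using this
        exact mul_mem h3 (inv_mem (hLn.conj_mem n h3 g))
      · have h3 := hLn.conj_mem _ (mul_mem h1 (inv_mem h2)) a
        simpa [mul_assoc] using h3
  have hNN : ⁅⁅N, (⊤ : Subgroup G)⁆, (⊤ : Subgroup G)⁆ ≤ N.squares := by
    refine (commutator_mono hNL le_rfl).trans ?_
    rw [commutator_le]
    intro x hx g _
    obtain ⟨_, ⟨i, rfl⟩, s, hs, rfl⟩ := mem_sup_of_normal_right.1 hx
    have hzi : ∀ k, k * z ^ i = z ^ i * k := mem_center_iff.1 (zpow_mem hz i)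
    have : ⁅z ^ i * s, g⁆ = s * (g * s⁻¹ * g⁻¹) := by
      rw [commutatorElement_def, ← hzi s, mul_assoc s, ← hzi g]
      simp [mul_assoc]
    change ⁅z ^ i * s, g⁆ ∈ _
    rw [this]
    exact mul_mem hs (Normal.conj_mem inferInstance _ (inv_mem hs) g)
  have hG' : _root_.commutator G ≤ ⁅N, (⊤ : Subgroup G)⁆ := commutator_top_le_of_sup_zpowers hNb le_rfl
  have hza : z ∈ zpowers a := by
    have hle : ⁅_root_.commutator G, (⊤ : Subgroup G)⁆ ⊔ (_root_.commutator G).squares ≤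
        N.squares :=
      sup_le ((commutator_mono hG' le_rfl).trans hNN)
        (squares_mono (hG'.trans (commutator_le_left N ⊤)))
    exact hsq (hle hzR)
  have hNa : N = zpowers a := by rw [hN, sup_eq_left, hZ, zpowers_le]; exact hza
  rw [hNa] at hNn hNb
  exact isMetacyclic_iff.2 ⟨a, b, hNn, hNb⟩

/-- In a group with central squares all of whose subgroups are two-generated, a commutator of order
at most two is a square. -/
theorem exists_sq_eq_commutator {G : Type*} [Group G] [Finite G] {x y c : G}
    (hc : ⁅x, y⁆ = c) (hc2 : c ^ 2 = 1)
    (hPc : (⊤ : Subgroup G).squares ≤ center G)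
    (hr : ∀ H : Subgroup G, H.squares.relIndex H ≤ 4) : ∃ v : G, v ^ 2 = c := by
  by_contra! hsq
  set P := (⊤ : Subgroup G).squares with hP
  have hcP : c ∈ P := hc ▸ (⊤ : Subgroup G).commutator_le_squares
    (commutator_mem_commutator (mem_top x) (mem_top y))
  have hsP : ∀ g : G, g ^ 2 ∈ P := fun g => sq_mem_squares (mem_top g)
  have hPcm : ∀ p ∈ P, ∀ g, Commute g p := fun p hp g => mem_center_iff.1 (hPc hp) g
  set D := P.squares ⊔ zpowers c with hD
  have hDP : P.squares ≤ D := le_sup_left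
  have hcD : c ∈ D := mem_sup_right (mem_zpowers c)
  have hPs : ∀ s ∈ P.squares, ∃ q ∈ P, s = q ^ 2 := by
    intro s hs
    induction hs using closure_induction with
    | mem s hs => obtain ⟨q, hq, rfl⟩ := hs; exact ⟨q, hq, rfl⟩
    | one => exact ⟨1, one_mem P, by simp⟩
    | mul s t _ _ hs ht =>
      obtain ⟨q, hq, rfl⟩ := hs
      obtain ⟨r, hr, rfl⟩ := ht
      exact ⟨q * r, mul_mem hq hr, ((hPcm r hr q).mul_pow 2).symm⟩
    | inv s _ hs =>
      obtain ⟨q, hq, rfl⟩ := hs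
      exact ⟨q⁻¹, inv_mem hq, by simp⟩
  have hc1 : c ≠ 1 := fun h => hsq 1 (by simp [h])
  -- The claim is that u^2 generates P/D, of order at most 2. The group M = ⟨u⟩P is abelian, so
  -- every element of M^2 is a square and c ∉ M^2. From |M : M^2| ≤ 4 and P < M follows |P : M^2| ≤
  -- 2, hence P = M^2⟨c⟩.
  have hTT : ∀ u v : G, ⁅u, v⁆ = c → ∀ p ∈ P, p ∈ D ∨ u ^ 2 * p ∈ D := by
    intro u v huv p hp
    have huP : u ∉ P := by
      intro hu
      apply hc1
      rw [← huv, commutatorElement_eq_one_iff_mul_comm]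
      exact (hPcm u hu v).symm
    set M := zpowers u ⊔ P with hM
    have hPM : P < M := lt_of_le_of_ne le_sup_right fun e =>
      huP (e ▸ mem_sup_left (mem_zpowers u))
    have hMs : ∀ s ∈ M.squares, ∃ (i : ℤ), ∃ q ∈ P, s = (u ^ i * q) ^ 2 := by
      intro s hs
      induction hs using closure_induction with
      | mem s hs =>
        obtain ⟨m, hm, rfl⟩ := hs
        obtain ⟨_, ⟨i, rfl⟩, q, hq, rfl⟩ := mem_sup_of_normal_right.1 hm
        exact ⟨i, q, hq, rfl⟩
      | one => exact ⟨0, 1, one_mem P, by simp⟩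
      | mul s t _ _ hs ht =>
        obtain ⟨i, q, hq, rfl⟩ := hs
        obtain ⟨j, r, hr, rfl⟩ := ht
        refine ⟨i + j, q * r, mul_mem hq hr, ?_⟩
        have e1 : u ^ (i + j) * (q * r) = (u ^ i * q) * (u ^ j * r) := by
          rw [zpow_add, mul_assoc, mul_assoc, ← mul_assoc (u ^ j) q r, (hPcm q hq (u ^ j)).eq,
            mul_assoc]
        have e2 : Commute (u ^ i * q) (u ^ j * r) := by
          refine Commute.mul_right ?_ (hPcm r hr _)
          exact Commute.mul_left ((Commute.refl u).zpow_zpow i j) (hPcm q hq _).symm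
        rw [e1, e2.mul_pow]
      | inv s _ hs =>
        obtain ⟨i, q, hq, rfl⟩ := hs
        refine ⟨-i, q⁻¹, inv_mem hq, ?_⟩
        rw [zpow_neg, ← (hPcm q hq (u ^ i)).inv_inv.eq.symm, ← mul_inv_rev, inv_pow]
    have hcM : c ∉ M.squares := by
      intro h
      obtain ⟨i, q, -, e⟩ := hMs c h
      exact hsq _ e.symm
    have hMP : M.squares ≤ P := squares_mono le_top
    have hidx : M.squares.relIndex P ≤ 2 := by
      have h1 := hr M
      rw [← relIndex_mul_relIndex _ _ _ hMP hPM.le] at h1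
      have h2 : P.relIndex M ≠ 1 := fun e => hPM.not_ge (relIndex_eq_one.1 e)
      have h3 : P.relIndex M ≠ 0 := index_ne_zero_of_finite
      have h4 : 2 ≤ P.relIndex M := by omega
      nlinarith
    have hdvd : M.squares.relIndex P ∣ 2 := by
      have h3 : M.squares.relIndex P ≠ 0 := index_ne_zero_of_finite
      rcases (by omega : M.squares.relIndex P = 1 ∨ M.squares.relIndex P = 2) with h | h
      · rw [h]; norm_num
      · rw [h]
    obtain ⟨a, -, ha⟩ := relIndex_dvd_two_iff.1 hdvd
    have hca := (ha c hcP).resolve_right hcM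
    have hMD : ∀ s ∈ M.squares, s ∈ D ∨ u ^ 2 * s ∈ D := by
      intro s hs
      obtain ⟨i, q, hq, rfl⟩ := hMs s hs
      rw [(hPcm q hq (u ^ i)).mul_pow, ← zpow_natCast (u ^ i), zpow_comm, zpow_natCast]
      have hu4 : (u ^ 2) ^ (2 : ℤ) ∈ D := by
        rw [zpow_ofNat]; exact hDP (sq_mem_squares (hsP u))
      have hq2 : q ^ 2 ∈ D := hDP (sq_mem_squares hq)
      rcases Int.even_or_odd' i with ⟨m, rfl | rfl⟩
      · left
        rw [zpow_mul]
        exact mul_mem (zpow_mem hu4 m) hq2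
      · right
        rw [← mul_assoc, ← zpow_one_add, (by ring : 1 + (2 * m + 1) = 2 * (m + 1)), zpow_mul]
        exact mul_mem (zpow_mem hu4 _) hq2
    rcases ha p hp with h | h
    · have h5 : p * c⁻¹ ∈ M.squares := by
        have := mul_mem h (inv_mem hca)
        simpa [mul_assoc] using this
      rcases hMD _ h5 with h6 | h6
      · left
        have := mul_mem h6 hcD
        rwa [inv_mul_cancel_right] at this
      · right
        have := mul_mem h6 hcD
        rwa [← mul_assoc, inv_mul_cancel_right] at this
    · exact hMD p h
  have hxyc : (x * y) ^ 2 = x ^ 2 * y ^ 2 * c := by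
    have h1 : y * x = c * (x * y) := by
      have : c⁻¹ = c := inv_eq_of_mul_eq_one_left (by rw [← sq, hc2])
      rw [← this, ← hc]
      simp [commutatorElement_def, mul_assoc]
    calc (x * y) ^ 2 = x * (y * x) * y := by simp [sq, mul_assoc]
      _ = x * (c * (x * y)) * y := by rw [h1]
      _ = x * c * (x * y * y) := by simp [mul_assoc]
      _ = c * (x * (x * y * y)) := by rw [(hPcm c hcP x).eq, mul_assoc]
      _ = (x * (x * y * y)) * c := (hPcm c hcP _).eq.symm
      _ = _ := by simp [sq, mul_assoc]
  have hyx : ⁅y, x⁆ = c := by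
    rw [← commutatorElement_inv, hc]
    exact inv_eq_of_mul_eq_one_left (by rw [← sq, hc2])
  have hxy' : ⁅x * y, y⁆ = c := by
    rw [← hc]; simp [commutatorElement_def, mul_assoc]
  have hDsq : ∀ g : G, g ^ 2 ∈ D → ∃ q ∈ P, g ^ 2 = q ^ 2 := by
    intro g hg
    obtain ⟨s, hs, _, ⟨k, rfl⟩, e⟩ := mem_sup_of_normal_left.1 hg
    obtain ⟨q, hq, rfl⟩ := hPs s hs
    have hc2' : c ^ (2 : ℤ) = 1 := by rw [zpow_ofNat, hc2]
    rcases Int.even_or_odd' k with ⟨m, rfl | rfl⟩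
    · refine ⟨q, hq, ?_⟩
      rw [← e]
      change q ^ 2 * c ^ (2 * m) = _
      rw [zpow_mul, hc2', one_zpow, mul_one]
    · exfalso
      have e' : q ^ 2 * c ^ (2 * m + 1) = g ^ 2 := e
      rw [zpow_add, zpow_mul, hc2', one_zpow, one_mul, zpow_one] at e'
      apply hsq (q⁻¹ * g)
      rw [((hPcm q hq g).symm.inv_left).mul_pow, ← e', inv_pow, inv_mul_cancel_left]
  -- The claim applies to u = x, y and xy. If x^2 ∈ D, then x^2 and y^2 are squares of central
  -- elements, and correcting xy by these gives a square root of c. Otherwise x^2, y^2 and (xy)^2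
  -- are all nontrivial in P/D, though (xy)^2 ≡ x^2 y^2 ≡ 1.
  by_cases hx : x ^ 2 ∈ D
  · have hy : y ^ 2 ∈ D := by
      rcases hTT x y hc _ (hsP y) with h | h
      · exact h
      · exact (mul_mem_cancel_left hx).1 h
    obtain ⟨p, hp, ep⟩ := hDsq x hx
    obtain ⟨q, hq, eq⟩ := hDsq y hy
    apply hsq ((p * q)⁻¹ * (x * y))
    rw [((hPcm _ (mul_mem hp hq) (x * y)).symm.inv_left).mul_pow, hxyc, ep, eq, inv_pow,
      ← (hPcm q hq p).mul_pow, inv_mul_cancel_left]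
  · have hy : y ^ 2 ∉ D := by
      intro hy
      rcases hTT y x hyx _ (hsP x) with h | h
      · exact hx h
      · exact hx ((mul_mem_cancel_left hy).1 h)
    have hxy2 : (x * y) ^ 2 ∈ D := by
      rw [hxyc]
      exact mul_mem ((hTT x y hc _ (hsP y)).resolve_left hy) hcD
    rcases hTT _ _ hxy' _ (hsP x) with h | h
    · exact hx h
    · exact hx ((mul_mem_cancel_left hxy2).1 h)

/-- ⟨v⟩ is normal as it contains G', and v, being outside the Frattini subgroup, is part of a
generating pair; its partner can be taken to be x or y. -/
theorem isMetacyclic_of_commutator_mem_zpowers {G : Type*} [Group G] [Finite G]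
    (hG : IsPGroup 2 G) {x y v : G} (hxy : zpowers x ⊔ zpowers y = ⊤)
    (hv : _root_.commutator G ≤ zpowers v) (hvP : v ∉ (⊤ : Subgroup G).squares) :
    IsMetacyclic G := by
  set P := (⊤ : Subgroup G).squares with hP
  have hn : (zpowers v).Normal := Normal.of_commutator_le _ hv
  have hodd : ∀ (g : G) (m : ℤ) (U : Subgroup G), P ≤ U → g ^ (2 * m + 1) ∈ U → g ∈ U := by
    intro g m U hU hg
    have h2 : g ^ (2 * m) ∈ U := by
      rw [zpow_mul]
      refine zpow_mem (hU ?_) m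
      rw [zpow_ofNat]
      exact sq_mem_squares (mem_top g)
    rw [zpow_add_one] at hg
    exact (mul_mem_cancel_left h2).1 hg
  have heven : ∀ (g : G) (m : ℤ), g ^ (2 * m) ∈ P := by
    intro g m
    rw [zpow_mul, zpow_ofNat]
    exact zpow_mem (sq_mem_squares (mem_top g)) m
  obtain ⟨w, hw⟩ : ∃ w : G, x ∈ zpowers v ⊔ zpowers w ⊔ P ∧ y ∈ zpowers v ⊔ zpowers w ⊔ P := by
    have hxP : (zpowers x ⊔ P).Normal :=
      Normal.of_commutator_le _ ((commutator_le_squares ⊤).trans le_sup_right)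
    have htop : zpowers y ⊔ (zpowers x ⊔ P) = ⊤ := by
      rw [← sup_assoc, sup_comm (zpowers y), hxy, top_sup_eq]
    have hmem : v ∈ zpowers y ⊔ (zpowers x ⊔ P) := htop ▸ mem_top v
    obtain ⟨_, ⟨j, rfl⟩, t, ht, e⟩ := mem_sup_of_normal_right.1 hmem
    obtain ⟨_, ⟨i, rfl⟩, p, hp, rfl⟩ := mem_sup_of_normal_right.1 ht
    have e' : y ^ j * (x ^ i * p) = v := e
    have hvU : ∀ w, v ∈ zpowers v ⊔ zpowers w ⊔ P := fun w =>
      mem_sup_left (mem_sup_left (mem_zpowers v))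
    have hwU : ∀ w, w ∈ zpowers v ⊔ zpowers w ⊔ P := fun w =>
      mem_sup_left (mem_sup_right (mem_zpowers w))
    have hpU : ∀ w, p ∈ zpowers v ⊔ zpowers w ⊔ P := fun w => mem_sup_right hp
    rcases Int.even_or_odd' i with ⟨m, hi | hi⟩
    · rcases Int.even_or_odd' j with ⟨l, hj | hj⟩
      · exfalso
        apply hvP
        rw [← e', hi, hj]
        exact mul_mem (heven y l) (mul_mem (heven x m) hp)
      · refine ⟨x, hwU x, hodd y l _ le_sup_right ?_⟩
        rw [← hj, eq_mul_inv_of_mul_eq e']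
        exact mul_mem (hvU x) (inv_mem (mul_mem (zpow_mem (hwU x) i) (hpU x)))
    · refine ⟨y, hodd x m _ le_sup_right ?_, hwU y⟩
      rw [← hi, eq_mul_inv_of_mul_eq (eq_inv_mul_of_mul_eq e')]
      exact mul_mem (mul_mem (inv_mem (zpow_mem (hwU y) j)) (hvU y)) (inv_mem (hpU y))
  refine isMetacyclic_iff.2 ⟨v, w, hn, eq_top_of_sup_squares_top hG ?_⟩
  exact top_unique (hxy.ge.trans (sup_le (zpowers_le.2 hw.1) (zpowers_le.2 hw.2)))

theorem isMetacyclic_of_commutator_le_center {G : Type*} [Group G] [Finite G] (hG : IsPGroup 2 G)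
    (hr : ∀ H : Subgroup G, Group.rank H ≤ 2)
    (h1 : ⁅_root_.commutator G, (⊤ : Subgroup G)⁆ = ⊥) (h2 : (_root_.commutator G).squares = ⊥) :
    IsMetacyclic G := by
  have hr' : ∀ H : Subgroup G, H.squares.relIndex H ≤ 4 := fun H => by
    rw [relIndex_squares hG]
    exact Nat.pow_le_pow_right two_pos (hr H)
  have hrG : Group.rank G ≤ 2 :=
    (Group.rank_le_of_surjective (⊤ : Subgroup G).subtype fun g => ⟨⟨g, mem_top g⟩, rfl⟩).trans
      (hr ⊤)
  obtain ⟨x, y, hxy⟩ := exists_zpowers_sup_eq_top hrG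
  have hcm : ∀ g h : G, ⁅g, h⁆ ∈ _root_.commutator G := fun g h =>
    commutator_mem_commutator (mem_top g) (mem_top h)
  have hcsq : ∀ k ∈ _root_.commutator G, k ^ 2 = 1 := fun k hk => by
    rw [← mem_bot, ← h2]; exact sq_mem_squares hk
  have hcc : _root_.commutator G ≤ center G := by
    intro k hk
    rw [mem_center_iff]
    intro g
    have : ⁅k, g⁆ = 1 := by
      rw [← mem_bot, ← h1]; exact commutator_mem_commutator hk (mem_top g)
    exact (commutatorElement_eq_one_iff_mul_comm.1 this).symm
  have hPc : (⊤ : Subgroup G).squares ≤ center G := by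
    rw [squares_le_iff]
    intro g _
    rw [mem_center_iff]
    intro k
    have : ⁅g ^ 2, k⁆ = 1 := by
      rw [commutatorElement_sq_left, hcsq _ (hcm g k), mul_one,
        commutatorElement_eq_one_iff_mul_comm]
      exact mem_center_iff.1 (hcc (hcm g k)) g
    exact (commutatorElement_eq_one_iff_mul_comm.1 this).symm
  set c := ⁅x, y⁆ with hc
  have hcC : c ∈ center G := hcc (hcm x y)
  have hc2 : c ^ 2 = 1 := hcsq c (hcm x y)
  have hcn : (zpowers c).Normal := ⟨by
    rintro _ ⟨k, rfl⟩ g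
    have : g * c ^ k * g⁻¹ = c ^ k := by
      rw [mem_center_iff.1 (zpow_mem hcC k) g, mul_inv_cancel_right]
    change g * c ^ k * g⁻¹ ∈ _
    rw [this]
    exact zpow_mem (mem_zpowers c) k⟩
  have hGc : _root_.commutator G ≤ zpowers c := by
    refine commutator_top_le_of_sup_zpowers hxy ?_
    let π := QuotientGroup.mk' (zpowers c)
    have hsurj : Function.Surjective π := QuotientGroup.mk'_surjective _
    have hx : zpowers x ⊔ zpowers y ≤ (centralizer {π x}).comap π := by
      rw [sup_le_iff, zpowers_le, zpowers_le, mem_comap, mem_comap, mem_centralizer_singleton_iff,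
        mem_centralizer_singleton_iff]
      refine ⟨rfl, ?_⟩
      have : π ⁅x, y⁆ = 1 := (QuotientGroup.eq_one_iff _).2 (mem_zpowers c)
      rw [map_commutatorElement, commutatorElement_eq_one_iff_mul_comm] at this
      exact this.symm
    rw [hxy] at hx
    rw [commutator_le]
    rintro _ ⟨k, rfl⟩ g _
    have hg := hx (mem_top g)
    rw [mem_comap, mem_centralizer_singleton_iff] at hg
    have hk : Commute (π (x ^ k)) (π g) := by
      rw [map_zpow]
      refine Commute.zpow_left ?_ k
      exact hg.symm
    rw [← QuotientGroup.eq_one_iff]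
    change π ⁅x ^ k, g⁆ = 1
    rw [map_commutatorElement, commutatorElement_eq_one_iff_mul_comm]
    exact hk
  by_cases hc1 : c = 1
  · have hbot : _root_.commutator G ≤ ⊥ := by rwa [hc1, zpowers_one_eq_bot] at hGc
    exact isMetacyclic_iff.2 ⟨x, y, Normal.of_commutator_le _ (hbot.trans bot_le), hxy⟩
  by_contra hnm
  -- If G is not metacyclic, every root of c is a Frattini element, hence w^2 or w^2 c for some w.
  -- In both cases its square is w^4, so roots of c can be extracted indefinitely.
  have hout : ∀ v, c ∈ zpowers v → v ∈ (⊤ : Subgroup G).squares := by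
    intro v hv
    by_contra hvP
    exact hnm (isMetacyclic_of_commutator_mem_zpowers hG hxy
      (hGc.trans (by rwa [zpowers_le])) hvP)
  have hsq : ∀ u ∈ (⊤ : Subgroup G).squares, ∃ w : G, u = w ^ 2 ∨ u = w ^ 2 * c := by
    have hccm : ∀ g, Commute g c := fun g => mem_center_iff.1 hcC g
    have hcc1 : c * c = 1 := by rw [← sq, hc2]
    have hmul : ∀ u v : G, u ^ 2 * v ^ 2 = (u * v) ^ 2 ∨ u ^ 2 * v ^ 2 = (u * v) ^ 2 * c := by
      intro u v
      have h3 : (u * v) ^ 2 = u ^ 2 * v ^ 2 * ⁅v, u⁆ := by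
        have h4 := mem_center_iff.1 (hcc (hcm v u))
        have h5 : v * u = ⁅v, u⁆ * (u * v) := by simp [commutatorElement_def, mul_assoc]
        calc (u * v) ^ 2 = u * (v * u) * v := by simp [sq, mul_assoc]
          _ = u * (⁅v, u⁆ * (u * v)) * v := by rw [← h5]
          _ = u * (u * v * ⁅v, u⁆) * v := by rw [h4]
          _ = u * u * v * (⁅v, u⁆ * v) := by simp only [mul_assoc]
          _ = u * u * v * (v * ⁅v, u⁆) := by rw [h4]
          _ = _ := by simp only [sq, mul_assoc]
      obtain ⟨k, hk⟩ := hGc (hcm v u)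
      have hk' : c ^ k = ⁅v, u⁆ := hk
      have hc2' : c ^ (2 : ℤ) = 1 := by rw [zpow_ofNat, hc2]
      rw [h3, ← hk']
      rcases Int.even_or_odd' k with ⟨m, rfl | rfl⟩
      · left; rw [zpow_mul, hc2', one_zpow, mul_one]
      · right; rw [zpow_add, zpow_mul, hc2', one_zpow, one_mul, zpow_one, mul_assoc, hcc1, mul_one]
    intro u hu
    induction hu using closure_induction with
    | mem s hs => obtain ⟨q, -, rfl⟩ := hs; exact ⟨q, Or.inl rfl⟩
    | one => exact ⟨1, Or.inl (by simp)⟩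
    | mul s t _ _ hs ht =>
      obtain ⟨a, ha⟩ := hs
      obtain ⟨b, hb⟩ := ht
      refine ⟨a * b, ?_⟩
      have h6 : a ^ 2 * c * b ^ 2 = a ^ 2 * b ^ 2 * c := by
        rw [mul_assoc, ← (hccm (b ^ 2)).eq, mul_assoc]
      rcases ha with rfl | rfl <;> rcases hb with rfl | rfl <;>
        rcases hmul a b with h | h <;>
        simp [← mul_assoc, h6, h] <;> simp [mul_assoc, hcc1]
    | inv s _ hs =>
      obtain ⟨a, ha⟩ := hs
      have hci : c⁻¹ = c := inv_eq_of_mul_eq_one_left hcc1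
      refine ⟨a⁻¹, ?_⟩
      rcases ha with rfl | rfl
      · left; simp
      · right; rw [mul_inv_rev, hci, inv_pow, (hccm _).eq]
  have hpow : ∀ k : ℕ, ∃ u : G, u ^ 2 ^ (k + 1) = c := by
    intro k
    induction k with
    | zero =>
      obtain ⟨v, hv⟩ := exists_sq_eq_commutator hc.symm hc2 hPc hr'
      exact ⟨v, by simpa using hv⟩
    | succ k ih =>
      obtain ⟨u, hu⟩ := ih
      obtain ⟨w, hw⟩ := hsq u (hout u (hu ▸ pow_mem (mem_zpowers u) _))
      have hu2 : u ^ 2 = w ^ 4 := by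
        rcases hw with rfl | rfl
        · rw [← pow_mul]
        · rw [(show Commute (w ^ 2) c from mem_center_iff.1 hcC _).mul_pow, hc2, mul_one, ← pow_mul]
      refine ⟨w, ?_⟩
      rw [← hu, pow_succ' 2 k, pow_mul u, hu2, ← pow_mul]
      congr 1
      ring
  have : Fact (Nat.Prime 2) := ⟨Nat.prime_two⟩
  obtain ⟨n, hn⟩ := IsPGroup.iff_card.1 hG
  obtain ⟨u, hu⟩ := hpow n
  apply hc1
  rw [← hu, pow_succ, pow_mul, ← hn, pow_card_eq_one', one_pow]

/-- A `2`-group all of whose subgroups are two-generated is metacyclic. -/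
theorem isMetacyclic_of_forall_rank_le {G : Type*} [Group G] [Finite G] (hG : IsPGroup 2 G)
    (hr : ∀ H : Subgroup G, Group.rank H ≤ 2) : IsMetacyclic G := by
  induction hn : Nat.card G using Nat.strong_induction_on generalizing G with
  | _ n ih =>
  have : Fact (Nat.Prime 2) := ⟨Nat.prime_two⟩
  have := hG.isNilpotent
  set R := ⁅_root_.commutator G, (⊤ : Subgroup G)⁆ ⊔ (_root_.commutator G).squares with hR
  by_cases hRb : R = ⊥
  · rw [hR, sup_eq_bot_iff] at hRb
    exact isMetacyclic_of_commutator_le_center hG hr hRb.1 hRb.2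
  have hRn : R.Normal := inferInstance
  -- A minimal nontrivial normal subgroup inside R is central by nilpotency; a power of one of its
  -- elements is the required involution.
  obtain ⟨z, hzR, hz1, hzc, hz2⟩ : ∃ z ∈ R, z ≠ 1 ∧ z ∈ center G ∧ z ^ 2 = 1 := by
    obtain ⟨x, hx, hx1⟩ : ∃ x ∈ R ⊓ center G, x ≠ 1 := by
      by_contra! hall
      have hfin : {T : Subgroup G | T.Normal ∧ T ≤ R ∧ T ≠ ⊥}.Finite := Set.toFinite _
      obtain ⟨T, ⟨hT, hTR, hT1⟩, hmin⟩ := hfin.exists_minimal ⟨R, hRn, le_rfl, hRb⟩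
      by_cases hTc : ⁅T, (⊤ : Subgroup G)⁆ = ⊥
      · apply hT1
        rw [eq_bot_iff]
        intro t ht
        refine mem_bot.2 (hall t ⟨hTR ht, mem_center_iff.2 fun g => ?_⟩)
        have h1 : ⁅t, g⁆ = 1 := by
          rw [← mem_bot, ← hTc]; exact commutator_mem_commutator ht (mem_top g)
        exact (commutatorElement_eq_one_iff_mul_comm.1 h1).symm
      · have hle := commutator_le_left T (⊤ : Subgroup G)
        exact hT1 (eq_bot_of_le_commutator_top
          (hmin ⟨inferInstance, hle.trans hTR, hTc⟩ hle))
    obtain ⟨k, hk⟩ := (IsPGroup.iff_orderOf.1 hG) x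
    obtain ⟨k, rfl⟩ : ∃ l, k = l + 1 := Nat.exists_eq_succ_of_ne_zero (by
      rintro rfl; exact hx1 (orderOf_eq_one_iff.1 (by simpa using hk)))
    refine ⟨x ^ 2 ^ k, pow_mem hx.1 _, ?_, pow_mem hx.2 _, ?_⟩
    · exact pow_ne_one_of_lt_orderOf (by positivity)
        (hk ▸ Nat.pow_lt_pow_right one_lt_two (Nat.lt_succ_self k))
    · rw [← pow_mul, ← pow_succ, ← hk, pow_orderOf_eq_one]
  have hzn : (zpowers z).Normal := ⟨by
    rintro _ ⟨k, rfl⟩ g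
    have : g * z ^ k * g⁻¹ = z ^ k := by
      rw [mem_center_iff.1 (zpow_mem hzc k) g, mul_inv_cancel_right]
    change g * z ^ k * g⁻¹ ∈ _
    rw [this]
    exact zpow_mem (mem_zpowers z) k⟩
  refine isMetacyclic_of_quotient_zpowers hzc hz2 hzR (ih _ ?_ (hG.to_quotient _) ?_ rfl)
  · rw [← hn, card_eq_card_quotient_mul_card_subgroup (zpowers z)]
    have h1 : 1 < Nat.card (zpowers z) := by
      rw [one_lt_card_iff_ne_bot]; exact fun h => hz1 (zpowers_eq_bot.1 h)
    have h2 : 0 < Nat.card (G ⧸ zpowers z) := Nat.card_pos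
    nlinarith
  · intro K
    exact (Group.rank_le_of_surjective _ (MonoidHom.subgroupComap_surjective_of_surjective
      (QuotientGroup.mk' (zpowers z)) K (QuotientGroup.mk'_surjective _))).trans (hr _)

/-! ### Lifting minimal non-metacyclicity. -/

theorem IsMinimalNonMetacyclic.of_quotient_powSubgroup {G : Type*} [Group G] [Finite G]
    (hG : IsPGroup 2 G) (h : IsMinimalNonMetacyclic (G ⧸ powSubgroup G 4)) :
    IsMinimalNonMetacyclic G := by
  obtain ⟨hnot, hsub⟩ := h
  refine ⟨fun hm => hnot (hm.of_surjective _ (QuotientGroup.mk'_surjective _)), ?_⟩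
  have hle : ∀ K : Subgroup (G ⧸ powSubgroup G 4), K ≠ ⊤ → Group.rank K ≤ 2 := fun K hK =>
    (hsub K hK).rank_le
  have hrk : 2 < Group.rank (G ⧸ powSubgroup G 4) := by
    by_contra! hlt
    refine hnot (isMetacyclic_of_forall_rank_le (hG.to_quotient _) fun K => ?_)
    by_cases hK : K = ⊤
    · subst hK
      rwa [Group.rank_congr Subgroup.topEquiv]
    · exact hle K hK
  -- The trivial group of automorphisms serves as operator group, so every subgroup is invariant.
  have hd : IsDMaximalFor (⊥ : Subgroup (MulAut G)) (G ⧸ powSubgroup G 4) := fun K _ hK =>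
    (hle K hK).trans_lt hrk
  have htriv : ∀ (a : (⊥ : Subgroup (MulAut G))) (g : G), a • g = g := by
    rintro ⟨a, ha⟩ g
    rw [mem_bot] at ha
    subst ha
    rfl
  have hrank : ∀ H : Subgroup G, H ≠ ⊤ → Group.rank H ≤ 2 := by
    intro H hH
    obtain ⟨K, -, hK, hHK⟩ := hd.exists_rank_le hG IsPGroup.of_bot
      (fun a h hh => by rwa [htriv]) hH
    exact hHK.trans (hle K hK)
  intro H hH
  refine isMetacyclic_of_forall_rank_le (hG.to_subgroup H) fun L => ?_
  have e : L ≃* L.map H.subtype := L.equivMapOfInjective _ H.subtype_injective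
  rw [Group.rank_congr e]
  refine hrank _ fun ht => hH (top_unique (ht ▸ map_subtype_le L))

theorem mainTheorem5 {G A : Type*} [Group G] [Finite G] [Group A] [Finite A]
    [MulDistribMulAction A G] (hG : IsPGroup 2 G) (hA : IsPGroup 2 A) :
    (IsDMaximalFor A (G ⧸ powSubgroup G 4) → IsDMaximalFor A G) ∧
      (IsMinimalNonMetacyclic (G ⧸ powSubgroup G 4) → IsMinimalNonMetacyclic G) :=
  ⟨fun h => h.of_quotient_powSubgroup hG hA, fun h => h.of_quotient_powSubgroup hG⟩
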